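/- A finite simplicial complex is a finite family $\Gamma$ of finite sets that contains $\emptyset$ and is closed under taking subsets; $\dim\sigma=|\sigma|-1$ for $\sigma\in\Gamma$, $\dim\Gamma$ is the maximum dimension of a face, $V(\Gamma)=\{v:\{v\}\in\Gamma\}$, a facet is an inclusion-maximal face, and $\overline{\sigma}$ is the set of all subsets of $\sigma$. $\Gamma$ is shellable if its facets can be ordered $\sigma_1,\dots,\sigma_t$ so that for every $2\le j\le t$ the complex $\bigl(\bigcup_{i<j}\overline{\sigma_i}\bigr)\cap\overline{\sigma_j}$ is pure of dimension $\dim\sigma_j-1$ (all its facets have that dimension). For $W\subseteq V(\Gamma)$ let $\Gamma[W]=\{\sigma\in\Gamma:\sigma\subseteq W\}$. $\Gamma$ is an obstruction to shellability if $\Gamma$ is not shellable but $\Gamma[W]$ is shellable for every $W\subsetneq V(\Gamma)$. A complex $\Gamma'$ is obtained from $\Gamma$ by adding zero or more edges if $\Gamma\subseteq\Gamma'$ and every face in $\Gamma'\setminus\Gamma$ has dimension $1$. A 2-dimensional obstruction to shellability $\Gamma$ is edge-minimal if no 2-dimensional obstruction to shellability $\Delta\ne\Gamma$ exists such that $\Gamma$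 is obtained from $\Delta$ by adding edges. Write $ijk$ for $\{i,j,k\}$ and $ij$ for $\{i,j\}$. Consider the following twelve complexes, given by their facets: * (1a) $012,\ 345,\ 03,\ 14,\ 25$; * (1b) $012,\ 345,\ 23,\ 03,\ 04,\ 14$; * (1c) $012,\ 345,\ 03,\ 13,\ 14,\ 04$; * (2) $012,\ 034,\ 13$; * (3a) $012,\ 034,\ 123$; * (3b) $012,\ 034,\ 123,\ 124$; * (3c) $012,\ 034,\ 123,\ 134$; * (3d) $012,\ 034,\ 123,\ 124,\ 134$; * (3e) $012,\ 034,\ 123,\ 124,\ 134,\ 234$; * (4a), (4b), (4c): the triangles $\{i,i+1,i+2\}$, $i\in\mathbb{Z}/n$, on the vertex set $\mathbb{Z}/n$ with $n=5,6,7$, respectively. **Theorem.** A finite simplicial complex is a 2-dimensional edge-minimal obstruction to shellability if and only if it is isomorphic to one of the twelve complexes (1a)–(1c), (2), (3a)–(3e), (4a)–(4c). Hence the obstructions to shellability of dimension $\le 2$ are exactly the complexes that are isomorphic to $2K_2$ (the complex on four vertices whose facets are two disjoint edges) or are obtained by adding zero or more edges to a complex isomorphic to one of these twelve. -/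

import Mathlib

/-- A finite abstract simplicial complex: a finite family of finite subsets of `E`, closed under
taking subsets and containing the empty face (of dimension `-1`). Mathlib's
`PreAbstractSimplicialComplex` excludes the empty face, hence this structure.
Elements of `E` need not be vertices. -/
@[ext]
structure FinComplex (E : Type*) where
  faces : Finset (Finset E)
  empty_mem : ∅ ∈ faces
  down_closed : ∀ s ∈ faces, ∀ t, t ⊆ s → t ∈ faces

namespace FinComplex

/-- The dimension of a face, `|σ| - 1`. -/
def faceDim {E : Type*} (σ : Finset E) : ℤ := (σ.card : ℤ) - 1

/-- The set of vertices `V(Γ) = {v | {v} ∈ Γ}`. -/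
def vertexSet {E : Type*} (Γ : FinComplex E) : Set E := {v | {v} ∈ Γ.faces}

/-- The dimension of a complex: the maximum dimension of its faces. -/
def dim {E : Type*} (Γ : FinComplex E) : ℤ := ((Γ.faces.sup Finset.card : ℕ) : ℤ) - 1

/-- A facet is a face that is maximal with respect to inclusion. -/
def IsFacet {E : Type*} (Γ : FinComplex E) (σ : Finset E) : Prop :=
  Maximal (fun τ => τ ∈ Γ.faces) σ

/-- A family of faces is pure of dimension `d` if it is nonempty and all its
inclusion-maximal members have dimension `d`. -/
def IsPureOfDim {E : Type*} (F : Finset (Finset E)) (d : ℤ) : Prop :=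
  F.Nonempty ∧ ∀ σ, Maximal (fun τ => τ ∈ F) σ → faceDim σ = d

/-- The restriction `Γ[W]`: the faces of `Γ` contained in `W`. -/
def restrict {E : Type*} [DecidableEq E] (Γ : FinComplex E) (W : Finset E) : FinComplex E where
  faces := Γ.faces.filter (fun s => s ⊆ W)
  empty_mem := by simp [Γ.empty_mem]
  down_closed := by
    intro s hs t hts
    rw [Finset.mem_filter] at hs ⊢
    exact ⟨Γ.down_closed s hs.1 t hts, hts.trans hs.2⟩

/-- A (nonpure) shelling: an enumeration `σ₀, σ₁, …` of all facets such that, for each `j ≥ 1`,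
the complex `(⋃ i < j, closure of σᵢ) ∩ (closure of σⱼ)` is pure of dimension `dim σⱼ - 1`. The
closure of a face is the family of all its subsets. -/
def IsShelling {E : Type*} [DecidableEq E] (Γ : FinComplex E) (l : List (Finset E)) : Prop :=
  l.Nodup ∧ (∀ σ, σ ∈ l ↔ Γ.IsFacet σ) ∧
    ∀ (j : ℕ) (hj : j < l.length), 1 ≤ j →
      IsPureOfDim ((l.take j).toFinset.biUnion Finset.powerset ∩ (l[j]).powerset)
        (faceDim l[j] - 1)

def IsShellable {E : Type*} [DecidableEq E] (Γ : FinComplex E) : Prop :=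
  ∃ l : List (Finset E), Γ.IsShelling l

/-- An obstruction to shellability: not shellable, but all proper restrictions are. -/
def IsObstruction {E : Type*} [DecidableEq E] (Γ : FinComplex E) : Prop :=
  ¬ Γ.IsShellable ∧ ∀ W : Finset E, (W : Set E) ⊂ Γ.vertexSet → (Γ.restrict W).IsShellable

/-- `Γ'` arises from `Γ` by adding zero or more edges: `Γ ⊆ Γ'`, and all new faces are
1-dimensional. In particular `Γ` and `Γ'` have the same vertices. -/
def IsAddEdges {E : Type*} (Γ Γ' : FinComplex E) : Prop :=
  Γ.faces ⊆ Γ'.faces ∧ ∀ s ∈ Γ'.faces, s ∉ Γ.faces → faceDim s = 1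

/-- A 2-dimensional obstruction to shellability is edge-minimal if removing edges from it never
gives another 2-dimensional obstruction. -/
def IsEdgeMinimalObstruction {E : Type*} [DecidableEq E] (Γ : FinComplex E) : Prop :=
  (Γ.IsObstruction ∧ Γ.dim = 2) ∧
    ∀ Δ : FinComplex E, Δ.IsObstruction → Δ.dim = 2 → IsAddEdges Δ Γ → Δ = Γ

/-- Isomorphism of complexes: a bijection of the vertex sets under which faces correspond to
faces. -/
def IsIso {E F : Type*} (Γ : FinComplex E) (Δ : FinComplex F) : Prop :=
  ∃ f : Γ.vertexSet ≃ Δ.vertexSet, ∀ s : Finset Γ.vertexSet,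
    s.map (Function.Embedding.subtype _) ∈ Γ.faces ↔
      (s.map f.toEmbedding).map (Function.Embedding.subtype _) ∈ Δ.faces

/-- The complex generated by a family of sets: all subsets of its members, and `∅`. -/
def generatedBy {E : Type*} [DecidableEq E] (F : Finset (Finset E)) : FinComplex E where
  faces := insert ∅ (F.biUnion Finset.powerset)
  empty_mem := by simp
  down_closed := by
    intro s hs t hts
    simp only [Finset.mem_insert, Finset.mem_biUnion, Finset.mem_powerset] at hs ⊢
    rcases hs with rfl | ⟨a, ha, hsa⟩
    · exact Or.inl (Finset.subset_empty.mp hts)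
    · exact Or.inr ⟨a, ha, hts.trans hsa⟩

/-- `2K₂`: two disjoint edges on four vertices. -/
def twoK2 : FinComplex (Fin 4) := generatedBy {{0, 1}, {2, 3}}

/-- Two disjoint triangles and a perfect matching of three edges between them. -/
def complex1a : FinComplex (Fin 7) :=
  generatedBy {{0, 1, 2}, {3, 4, 5}, {0, 3}, {1, 4}, {2, 5}}

/-- Two disjoint triangles and a path of four edges between them. -/
def complex1b : FinComplex (Fin 7) :=
  generatedBy {{0, 1, 2}, {3, 4, 5}, {2, 3}, {0, 3}, {0, 4}, {1, 4}}

/-- Two disjoint triangles and a cycle of four edges between them. -/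
def complex1c : FinComplex (Fin 7) :=
  generatedBy {{0, 1, 2}, {3, 4, 5}, {0, 3}, {1, 3}, {1, 4}, {0, 4}}

/-- Two triangles sharing one vertex and one edge joining them. -/
def complex2 : FinComplex (Fin 7) :=
  generatedBy {{0, 1, 2}, {0, 3, 4}, {1, 3}}

/-- Two triangles sharing the vertex `0`, and one triangle on `1, 2, 3, 4`. -/
def complex3a : FinComplex (Fin 7) :=
  generatedBy {{0, 1, 2}, {0, 3, 4}, {1, 2, 3}}

/-- Two triangles sharing the vertex `0`, and the two triangles on `1, 2, 3, 4` that
contain `{1, 2}`. -/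
def complex3b : FinComplex (Fin 7) :=
  generatedBy {{0, 1, 2}, {0, 3, 4}, {1, 2, 3}, {1, 2, 4}}

/-- Two triangles sharing the vertex `0`, and two triangles on `1, 2, 3, 4`, one containing
`{1, 2}` and one containing `{3, 4}`. -/
def complex3c : FinComplex (Fin 7) :=
  generatedBy {{0, 1, 2}, {0, 3, 4}, {1, 2, 3}, {1, 3, 4}}

/-- Two triangles sharing the vertex `0`, and three triangles on `1, 2, 3, 4`. -/
def complex3d : FinComplex (Fin 7) :=
  generatedBy {{0, 1, 2}, {0, 3, 4}, {1, 2, 3}, {1, 2, 4}, {1, 3, 4}}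

/-- Two triangles sharing the vertex `0`, and all four triangles on `1, 2, 3, 4`. -/
def complex3e : FinComplex (Fin 7) :=
  generatedBy {{0, 1, 2}, {0, 3, 4}, {1, 2, 3}, {1, 2, 4}, {1, 3, 4}, {2, 3, 4}}

/-- The band with triangles `{i, i+1, i+2}` modulo 5 (a Möbius band). -/
def complex4a : FinComplex (Fin 7) :=
  generatedBy {{0, 1, 2}, {1, 2, 3}, {2, 3, 4}, {3, 4, 0}, {4, 0, 1}}

/-- The band with triangles `{i, i+1, i+2}` modulo 6 (a cylinder). -/
def complex4b : FinComplex (Fin 7) :=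
  generatedBy {{0, 1, 2}, {1, 2, 3}, {2, 3, 4}, {3, 4, 5}, {4, 5, 0}, {5, 0, 1}}

/-- The band with triangles `{i, i+1, i+2}` modulo 7 (a Möbius band). -/
def complex4c : FinComplex (Fin 7) :=
  generatedBy {{0, 1, 2}, {1, 2, 3}, {2, 3, 4}, {3, 4, 5}, {4, 5, 6}, {5, 6, 0}, {6, 0, 1}}

/-- The twelve complexes of the classification. -/
def twelveComplexes : List (FinComplex (Fin 7)) :=
  [complex1a, complex1b, complex1c, complex2,
    complex3a, complex3b, complex3c, complex3d, complex3e,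
    complex4a, complex4b, complex4c]

end FinComplex

/-!
A complex of dimension at most 2 without an induced `2K₂` is shellable as soon as its family of
triangles is: the remaining edges and vertices can be attached afterwards. Hence a 2-dimensional
complex is an obstruction if and only if it has no induced `2K₂` and its triangles cover all
vertices and form a critical family, i.e. they cannot be shelled, but those within any set of
vertices that does not contain them all can.

For two disjoint triangles, Hall's theorem and the absence of an induced `2K₂` give the edges of
(1a)–(1c). A vertex whose link contains an induced `2K₂` already prevents shellability, so that
there are only five vertices, which gives (2) and (3a)–(3e). Otherwise, shell the deletion of a
vertex `v` and attach triangles as long as possible. Where this gets stuck, some edge `ab` of the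
link of `v` joins two parts of the link that are not connected by edges lying in triangles off `v`.
The coboundary of the indicator function of one part, extended by zero, is a cocycle on all
triangles. It is not a coboundary, whereas every cocycle of a shelled family is one; so already the
triangles carrying this argument are not shellable, and by criticality they contain all vertices.
This determines the triangles at `a` off `v`. The consecutive triangles around `ab` thus extend to
an infinite strip on at most seven vertices, which closes up to a band of length 5, 6 or 7, as in
(4a)–(4c).

In each of the twelve complexes, an edge outside the triangles is the only edge between two
edges of triangles, which would form an induced `2K₂` without it, so no edge can be removed.
-/

namespace FinComplex

open Finset

section Facets

variable {E : Type*} {Γ : FinComplex E} {σ s : Finset E}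

/-- The facets of a complex, as a finite family. -/
noncomputable def facets (Γ : FinComplex E) : Finset (Finset E) :=
  open Classical in {σ ∈ Γ.faces | Γ.IsFacet σ}

theorem mem_facets : σ ∈ Γ.facets ↔ Γ.IsFacet σ := by
  simp only [facets, mem_filter, and_iff_right_iff_imp]
  exact Maximal.prop

theorem mem_faces_of_mem_facets (hσ : σ ∈ Γ.facets) : σ ∈ Γ.faces :=
  (mem_facets.1 hσ).prop

theorem eq_of_mem_facets_of_subset (hσ : σ ∈ Γ.facets) (hs : s ∈ Γ.faces) (hσs : σ ⊆ s) : σ = s :=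
  (mem_facets.1 hσ).eq_of_le hs hσs

theorem isAntichain_facets : IsAntichain (· ⊆ ·) (Γ.facets : Set (Finset E)) :=
  fun _ hσ _ hτ hne hle => hne (eq_of_mem_facets_of_subset hσ (mem_faces_of_mem_facets hτ) hle)

theorem exists_mem_facets_superset (hs : s ∈ Γ.faces) : ∃ σ ∈ Γ.facets, s ⊆ σ := by
  obtain ⟨σ, hsσ, hσ⟩ := exists_le_maximal _ hs
  exact ⟨σ, mem_facets.2 hσ, hsσ⟩

theorem mem_facets_of_card {n : ℕ} (hn : ∀ s ∈ Γ.faces, #s ≤ n) (hσ : σ ∈ Γ.faces)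
    (hσn : #σ = n) : σ ∈ Γ.facets := by
  obtain ⟨τ, hτ, hστ⟩ := exists_mem_facets_superset hσ
  rwa [eq_of_subset_of_card_le hστ (hσn ▸ hn τ (mem_faces_of_mem_facets hτ))]

/-- The 2-dimensional faces of a complex. A 2-dimensional complex without an induced `2K₂` is
shellable exactly when this family is, which reduces the classification to families of 3-sets. -/
def triangles (Γ : FinComplex E) : Finset (Finset E) := {s ∈ Γ.faces | #s = 3}

theorem mem_triangles : s ∈ Γ.triangles ↔ s ∈ Γ.faces ∧ #s = 3 := mem_filter

theorem sized_triangles : (Γ.triangles : Set (Finset E)).Sized 3 :=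
  fun _ hs => (mem_triangles.1 hs).2

theorem mem_vertexSet_of_mem (hs : s ∈ Γ.faces) {x : E} (hx : x ∈ s) : x ∈ Γ.vertexSet :=
  Γ.down_closed s hs _ (singleton_subset_iff.2 hx)

theorem dim_le_iff {n : ℕ} : Γ.dim ≤ n ↔ ∀ s ∈ Γ.faces, #s ≤ n + 1 := by
  rw [← Finset.sup_le_iff, dim]
  omega

theorem dim_eq_two_iff : Γ.dim = 2 ↔ (∀ s ∈ Γ.faces, #s ≤ 3) ∧ Γ.triangles.Nonempty := by
  have h2 := dim_le_iff (Γ := Γ) (n := 2)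
  constructor
  · intro hd
    have hle : ∀ s ∈ Γ.faces, #s ≤ 3 := h2.1 hd.le
    obtain ⟨s, hs, hsup⟩ := exists_mem_eq_sup Γ.faces ⟨∅, Γ.empty_mem⟩ card
    rw [dim, hsup] at hd
    exact ⟨hle, s, mem_triangles.2 ⟨hs, by omega⟩⟩
  · rintro ⟨hle, s, hs⟩
    rw [mem_triangles] at hs
    have hsup : #s ≤ Γ.faces.sup card := le_sup hs.1
    have hd := h2.2 hle
    rw [dim] at hd ⊢
    push_cast at hd
    omega

variable [DecidableEq E]

theorem pair_mem_faces (hs : s ∈ Γ.faces) {x y : E} (hx : x ∈ s) (hy : y ∈ s) :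
    {x, y} ∈ Γ.faces :=
  Γ.down_closed s hs _ (insert_subset hx (singleton_subset_iff.2 hy))

theorem facets_eq_pair {τ : Finset E} (hσ : σ ∈ Γ.faces) (hτ : τ ∈ Γ.faces) (hστ : ¬ σ ⊆ τ)
    (hτσ : ¬ τ ⊆ σ) (h : ∀ s ∈ Γ.faces, s ⊆ σ ∨ s ⊆ τ) : Γ.facets = {σ, τ} := by
  have hsub : ∀ ρ ∈ Γ.facets, ρ = σ ∨ ρ = τ := fun ρ hρ =>
    (h ρ (mem_faces_of_mem_facets hρ)).imp (eq_of_mem_facets_of_subset hρ hσ)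
      (eq_of_mem_facets_of_subset hρ hτ)
  obtain ⟨σ', hσ', hσσ'⟩ := exists_mem_facets_superset hσ
  obtain ⟨τ', hτ', hττ'⟩ := exists_mem_facets_superset hτ
  obtain rfl : σ' = σ := (hsub σ' hσ').resolve_right fun h => hστ (h ▸ hσσ')
  obtain rfl : τ' = τ := (hsub τ' hτ').resolve_left fun h => hτσ (h ▸ hττ')
  ext ρ
  rw [mem_insert, mem_singleton]
  exact ⟨hsub ρ, by rintro (rfl | rfl) <;> assumption⟩

theorem mem_restrict {W : Finset E} : s ∈ (Γ.restrict W).faces ↔ s ∈ Γ.faces ∧ s ⊆ W := mem_filter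

theorem triangles_restrict (Γ : FinComplex E) (W : Finset E) :
    (Γ.restrict W).triangles = {σ ∈ Γ.triangles | σ ⊆ W} := by
  ext s
  simp only [mem_triangles, mem_restrict, mem_filter]
  tauto

end Facets

section Shelled

variable {E : Type*} [DecidableEq E] {S F : Finset (Finset E)} {σ τ : Finset E}

/-- `σ` may follow the members of `S` in a shelling: the closure of `σ` meets the complex generated
by `S` in a pure complex of codimension one in `σ`, or `S` is empty. -/
def Attaches (S : Finset (Finset E)) (σ : Finset E) : Prop :=
  ∀ τ ∈ S, ∃ τ' ∈ S, σ ∩ τ ⊆ τ' ∧ #(σ ∩ τ') + 1 = #σ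

/-- A family of finite sets that admits a shelling order. Unlike `IsShelling` this does not refer
to a complex, so that subfamilies of the facets can be shelled separately. -/
inductive Shelled : Finset (Finset E) → Prop
  | empty : Shelled ∅
  | attach {S : Finset (Finset E)} {σ : Finset E} :
      Shelled S → Attaches S σ → Shelled (insert σ S)

theorem attaches_empty (σ : Finset E) : Attaches ∅ σ := fun _ hτ => absurd hτ (notMem_empty _)

theorem Attaches.notMem (h : Attaches S σ) : σ ∉ S := by
  intro hσ
  obtain ⟨τ, -, hsub, hcard⟩ := h σ hσ
  rw [inter_self] at hsub
  rw [inter_eq_left.2 hsub] at hcard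
  omega

theorem attaches_iff_isPureOfDim (hS : S.Nonempty) :
    Attaches S σ ↔ IsPureOfDim (S.biUnion powerset ∩ σ.powerset) (faceDim σ - 1) := by
  have mem : ∀ ρ, ρ ∈ S.biUnion powerset ∩ σ.powerset ↔ (∃ τ ∈ S, ρ ⊆ τ) ∧ ρ ⊆ σ := by simp
  have inter_mem : ∀ τ ∈ S, σ ∩ τ ∈ S.biUnion powerset ∩ σ.powerset := fun τ hτ =>
    (mem _).2 ⟨⟨τ, hτ, inter_subset_right⟩, inter_subset_left⟩
  constructor
  · intro h
    refine ⟨hS.elim fun τ hτ => ⟨σ ∩ τ, inter_mem τ hτ⟩, fun ρ hρ => ?_⟩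
    obtain ⟨⟨τ, hτ, hρτ⟩, hρσ⟩ := (mem ρ).1 hρ.prop
    obtain ⟨τ', hτ', hsub, hcard⟩ := h τ hτ
    have hρ' : ρ = σ ∩ τ' := hρ.eq_of_le (inter_mem τ' hτ')
      (subset_inter hρσ ((subset_inter hρσ hρτ).trans hsub))
    rw [hρ', faceDim, faceDim]
    omega
  · rintro ⟨-, h⟩ τ hτ
    obtain ⟨ρ, hsub, hρ⟩ := exists_le_maximal _ (inter_mem τ hτ)
    obtain ⟨⟨τ', hτ', hρτ'⟩, hρσ⟩ := (mem ρ).1 hρ.prop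
    have hρ' : ρ = σ ∩ τ' := hρ.eq_of_le (inter_mem τ' hτ') (subset_inter hρσ hρτ')
    have hdim := h ρ hρ
    rw [hρ', faceDim, faceDim] at hdim
    exact ⟨τ', hτ', hsub.trans hρτ', by omega⟩

/-- The condition that `IsShelling` imposes on the order of the facets. -/
def IsShellingOrder (l : List (Finset E)) : Prop :=
  ∀ (j : ℕ) (hj : j < l.length), 1 ≤ j →
    IsPureOfDim ((l.take j).toFinset.biUnion powerset ∩ (l[j]).powerset) (faceDim l[j] - 1)

theorem isShellingOrder_concat {l : List (Finset E)} :
    IsShellingOrder (l ++ [σ]) ↔ IsShellingOrder l ∧ Attaches l.toFinset σ := by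
  have hlast : Attaches l.toFinset σ ↔ (1 ≤ l.length →
      IsPureOfDim (l.toFinset.biUnion powerset ∩ σ.powerset) (faceDim σ - 1)) := by
    rcases l.eq_nil_or_concat with rfl | ⟨l', τ, rfl⟩
    · simpa using attaches_empty σ
    · rw [attaches_iff_isPureOfDim ⟨τ, by simp⟩]
      simp
  rw [hlast]
  constructor
  · refine fun h => ⟨fun j hj hj1 => ?_, fun hl => ?_⟩
    · have hj' := h j (by rw [List.length_append]; omega) hj1
      rwa [List.getElem_append_left hj, List.take_append_of_le_length hj.le] at hj'
    · simpa using h l.length (by simp) hl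
  · rintro ⟨h, hl⟩ j hj hj1
    rw [List.length_append, List.length_singleton] at hj
    rcases (Nat.lt_succ_iff.1 hj).lt_or_eq with hlt | rfl
    · simpa only [List.getElem_append_left hlt, List.take_append_of_le_length hlt.le]
        using h j hlt hj1
    · simpa using hl hj1

theorem shelled_iff_exists_isShellingOrder :
    Shelled S ↔ ∃ l : List (Finset E), l.Nodup ∧ l.toFinset = S ∧ IsShellingOrder l := by
  constructor
  · intro h
    induction h with
    | empty => exact ⟨[], List.nodup_nil, rfl, fun j hj => absurd hj (Nat.not_lt_zero j)⟩
    | @attach S σ _ ha ih =>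
      obtain ⟨l, hnd, rfl, hl⟩ := ih
      have hσ : σ ∉ l := fun hσ => ha.notMem (List.mem_toFinset.2 hσ)
      refine ⟨l ++ [σ], ?_, ?_, isShellingOrder_concat.2 ⟨hl, ha⟩⟩
      · rw [← List.concat_eq_append]
        exact hnd.concat hσ
      · rw [List.toFinset_append, union_comm]
        rfl
  · rintro ⟨l, -, rfl, hl⟩
    induction l using List.reverseRecOn with
    | nil => exact .empty
    | append_singleton l σ ih =>
      obtain ⟨hl, ha⟩ := isShellingOrder_concat.1 hl
      rw [List.toFinset_append, union_comm]
      exact (ih hl).attach ha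

theorem isShellable_iff_shelled_facets {Γ : FinComplex E} : Γ.IsShellable ↔ Shelled Γ.facets := by
  rw [shelled_iff_exists_isShellingOrder]
  refine exists_congr fun l => and_congr_right fun _ => and_congr_left fun _ => ?_
  simp only [Finset.ext_iff, List.mem_toFinset, mem_facets]

theorem Shelled.of_forall_exists_attaches (hS : Shelled S) (hSF : S ⊆ F)
    (h : ∀ M, S ⊆ M → M ⊂ F → ∃ σ ∈ F, Attaches M σ) : Shelled F := by
  classical
  obtain ⟨M, hSM, hM⟩ := exists_le_maximal {M ∈ F.powerset | Shelled M}
    (mem_filter.2 ⟨mem_powerset.2 hSF, hS⟩)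
  obtain ⟨hMF, hMs⟩ := mem_filter.1 hM.prop
  rw [mem_powerset] at hMF
  obtain rfl | hne := hMF.eq_or_ssubset
  · exact hMs
  obtain ⟨σ, hσ, ha⟩ := h M hSM hne
  have hins : insert σ M ∈ {M ∈ F.powerset | Shelled M} :=
    mem_filter.2 ⟨mem_powerset.2 (insert_subset hσ hMF), hMs.attach ha⟩
  exact absurd (insert_eq_self.1 (hM.eq_of_le hins (subset_insert _ _)).symm) ha.notMem

theorem Shelled.filter_card_eq {n : ℕ} (h : Shelled S)
    (hS : IsAntichain (· ⊆ ·) (S : Set (Finset E))) (hn : ∀ σ ∈ S, #σ ≤ n) :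
    Shelled {σ ∈ S | #σ = n} := by
  induction h with
  | empty => exact .empty
  | @attach S σ _ ha ih =>
    have ih := ih (hS.subset (coe_subset.2 (subset_insert _ _)))
      fun τ hτ => hn τ (mem_insert_of_mem hτ)
    rw [filter_insert]
    split_ifs with hσ
    · refine ih.attach fun τ hτ => ?_
      obtain ⟨τ', hτ', hsub, hcard⟩ := ha τ (mem_filter.1 hτ).1
      refine ⟨τ', mem_filter.2 ⟨hτ', ?_⟩, hsub, hcard⟩
      by_contra hne
      have hle := hn τ' (mem_insert_of_mem hτ')
      have hτ'σ : τ' ⊆ σ :=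
        inter_eq_right.1 (eq_of_subset_of_card_le inter_subset_right (by omega))
      exact hne (hS.eq (mem_insert_of_mem hτ') (mem_insert_self _ _) hτ'σ ▸ hσ)
    · exact ih

theorem shelled_triangles {Γ : FinComplex E} (hΓ : ∀ s ∈ Γ.faces, #s ≤ 3) (h : Γ.IsShellable) :
    Shelled Γ.triangles := by
  have heq : Γ.triangles = {σ ∈ Γ.facets | #σ = 3} := by
    ext s
    rw [mem_triangles, mem_filter]
    exact and_congr_left fun hs =>
      ⟨fun h => mem_facets_of_card hΓ h hs, mem_faces_of_mem_facets⟩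
  rw [heq]
  exact (isShellable_iff_shelled_facets.1 h).filter_card_eq isAntichain_facets
    fun σ hσ => hΓ σ (mem_faces_of_mem_facets hσ)

theorem attaches_singleton {x : E} (h : ∀ τ ∈ S, x ∉ τ) : Attaches S {x} := fun τ hτ =>
  ⟨τ, hτ, inter_subset_right, by rw [singleton_inter_of_notMem (h τ hτ)]; rfl⟩

theorem attaches_of_card_eq_two (hσ : #σ = 2) (hsub : ∀ τ ∈ S, ¬ σ ⊆ τ)
    (hmeet : ∃ τ ∈ S, (σ ∩ τ).Nonempty) : Attaches S σ := by
  have hcard : ∀ τ ∈ S, (σ ∩ τ).Nonempty → #(σ ∩ τ) + 1 = #σ := by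
    intro τ hτ hne
    have hlt : #(σ ∩ τ) < #σ := card_lt_card
      (inter_subset_left.ssubset_of_ne fun h => hsub τ hτ (inter_eq_left.1 h))
    have hpos := hne.card_pos
    omega
  obtain ⟨τ₀, hτ₀, hne₀⟩ := hmeet
  intro τ hτ
  obtain hemp | hne := (σ ∩ τ).eq_empty_or_nonempty
  · exact ⟨τ₀, hτ₀, hemp ▸ empty_subset _, hcard τ₀ hτ₀ hne₀⟩
  · exact ⟨τ, hτ, inter_subset_right, hcard τ hτ hne⟩

theorem attaches_of_card_eq_three (hS : (S : Set (Finset E)).Sized 3) (hσ : #σ = 3) (hσS : σ ∉ S)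
    (hmeet : ∃ τ ∈ S, 2 ≤ #(σ ∩ τ))
    (hvertex : ∀ x ∈ σ, (∃ τ ∈ S, x ∈ τ) → ∃ τ ∈ S, x ∈ τ ∧ 2 ≤ #(σ ∩ τ)) : Attaches S σ := by
  have hcard : ∀ τ ∈ S, 2 ≤ #(σ ∩ τ) → #(σ ∩ τ) + 1 = #σ := by
    intro τ hτ h2
    have hlt : #(σ ∩ τ) < #σ := card_lt_card <| inter_subset_left.ssubset_of_ne fun h =>
      hσS (eq_of_subset_of_card_le (inter_eq_left.1 h) (by rw [hσ, hS hτ]) ▸ hτ)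
    omega
  intro τ hτ
  by_cases h2 : 2 ≤ #(σ ∩ τ)
  · exact ⟨τ, hτ, inter_subset_right, hcard τ hτ h2⟩
  obtain hemp | ⟨x, hx⟩ := (σ ∩ τ).eq_empty_or_nonempty
  · obtain ⟨τ', hτ', h2'⟩ := hmeet
    exact ⟨τ', hτ', hemp ▸ empty_subset _, hcard τ' hτ' h2'⟩
  · obtain ⟨hxσ, hxτ⟩ := mem_inter.1 hx
    obtain ⟨τ', hτ', hxτ', h2'⟩ := hvertex x hxσ ⟨τ, hτ, hxτ⟩
    refine ⟨τ', hτ', fun y hy => ?_, hcard τ' hτ' h2'⟩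
    rwa [card_le_one.1 (by omega : #(σ ∩ τ) ≤ 1) y hy x hx]

theorem attaches_triple (hS : (S : Set (Finset E)).Sized 3) {x y z : E}
    (hxyz : #{x, y, z} = 3) (hnew : {x, y, z} ∉ S) (hxy : ∃ τ ∈ S, x ∈ τ ∧ y ∈ τ)
    (hz : (∀ τ ∈ S, z ∉ τ) ∨ ∃ τ ∈ S, x ∈ τ ∧ z ∈ τ) : Attaches S {x, y, z} := by
  have two_le_card_inter : ∀ {p q : E} {τ : Finset E}, p ≠ q → p ∈ ({x, y, z} : Finset E) →
      q ∈ ({x, y, z} : Finset E) → p ∈ τ → q ∈ τ → 2 ≤ #({x, y, z} ∩ τ) :=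
    fun hpq hp hq hpτ hqτ => one_lt_card.2
      ⟨_, mem_inter.2 ⟨hp, hpτ⟩, _, mem_inter.2 ⟨hq, hqτ⟩, hpq⟩
  obtain ⟨hxy_ne, hxz_ne, -⟩ := card_triple_eq_three_iff.1 hxyz
  obtain ⟨τ, hτ, hx, hy⟩ := hxy
  have h2 : 2 ≤ #({x, y, z} ∩ τ) := two_le_card_inter hxy_ne (by simp) (by simp) hx hy
  refine attaches_of_card_eq_three hS hxyz hnew ⟨τ, hτ, h2⟩ ?_
  rintro w hw ⟨τ', hτ', hwτ'⟩
  simp only [mem_insert, mem_singleton] at hw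
  rcases hw with rfl | rfl | rfl
  · exact ⟨τ, hτ, hx, h2⟩
  · exact ⟨τ, hτ, hy, h2⟩
  · obtain hz | ⟨τ₂, hτ₂, hx₂, hz₂⟩ := hz
    · exact absurd hwτ' (hz τ' hτ')
    · exact ⟨τ₂, hτ₂, hz₂, two_le_card_inter hxz_ne (by simp) (by simp) hx₂ hz₂⟩

end Shelled

section Obstruction

variable {E : Type*} [DecidableEq E] {Γ : FinComplex E} {a b c d : E}

/-- The edges `ab` and `cd` are disjoint and no edge joins them; the distinctness of the four
vertices is implied, since e.g. `a = c` would make `{a, c} = {a}` a face. -/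
structure IsInducedTwoK2 (Γ : FinComplex E) (a b c d : E) : Prop where
  left_ne : a ≠ b
  right_ne : c ≠ d
  left_mem : {a, b} ∈ Γ.faces
  right_mem : {c, d} ∈ Γ.faces
  cross_notMem : ∀ x ∈ ({a, b} : Finset E), ∀ y ∈ ({c, d} : Finset E), {x, y} ∉ Γ.faces

/-- The graph of the edges has no induced `2K₂`. -/
def TwoK2Free (Γ : FinComplex E) : Prop := ∀ a b c d : E, ¬ Γ.IsInducedTwoK2 a b c d

theorem IsInducedTwoK2.disjoint (h : Γ.IsInducedTwoK2 a b c d) :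
    Disjoint ({a, b} : Finset E) {c, d} := by
  rw [disjoint_left]
  intro x hx hx'
  exact h.cross_notMem x hx x hx' (pair_mem_faces h.left_mem hx hx)

theorem IsInducedTwoK2.subset_or_subset (h : Γ.IsInducedTwoK2 a b c d) {s : Finset E}
    (hs : s ∈ (Γ.restrict ({a, b} ∪ {c, d})).faces) : s ⊆ {a, b} ∨ s ⊆ {c, d} := by
  obtain ⟨hs, hsub⟩ := mem_restrict.1 hs
  by_contra! hcon
  obtain ⟨y, hy, hy'⟩ := not_subset.1 hcon.1
  obtain ⟨x, hx, hx'⟩ := not_subset.1 hcon.2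
  exact h.cross_notMem x ((mem_union.1 (hsub hx)).resolve_right hx') y
    ((mem_union.1 (hsub hy)).resolve_left hy') (pair_mem_faces hs hx hy)

theorem IsInducedTwoK2.restrict {W : Finset E} (h : (Γ.restrict W).IsInducedTwoK2 a b c d) :
    Γ.IsInducedTwoK2 a b c d := by
  obtain ⟨hl, hlW⟩ := mem_restrict.1 h.left_mem
  obtain ⟨hr, hrW⟩ := mem_restrict.1 h.right_mem
  exact ⟨h.left_ne, h.right_ne, hl, hr, fun x hx y hy hxy => h.cross_notMem x hx y hy
    (mem_restrict.2 ⟨hxy, insert_subset (hlW hx) (singleton_subset_iff.2 (hrW hy))⟩)⟩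

theorem TwoK2Free.restrict (h : Γ.TwoK2Free) (W : Finset E) : (Γ.restrict W).TwoK2Free :=
  fun a b c d h' => h a b c d h'.restrict

/-- The edges follow the triangles in the shelling: an edge missing every face placed so far would
form an induced `2K₂` with an edge of one of those faces. -/
theorem shelled_filter_two_le_card (hΓ : ∀ s ∈ Γ.faces, #s ≤ 3) (hG : Γ.TwoK2Free)
    (hT : Shelled Γ.triangles) : Shelled {σ ∈ Γ.facets | 2 ≤ #σ} := by
  have hTsub : Γ.triangles ⊆ {σ ∈ Γ.facets | 2 ≤ #σ} := fun σ hσ => by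
    rw [mem_triangles] at hσ
    exact mem_filter.2 ⟨mem_facets_of_card hΓ hσ.1 hσ.2, by omega⟩
  refine hT.of_forall_exists_attaches hTsub fun M hTM hM => ?_
  by_contra! hstuck
  have hMfacet : ∀ τ ∈ M, τ ∈ Γ.facets ∧ 2 ≤ #τ := fun τ hτ => mem_filter.1 (hM.1 hτ)
  have misses : ∀ σ ∈ Γ.facets, 2 ≤ #σ → σ ∉ M → #σ = 2 ∧ ∀ τ ∈ M, ¬ (σ ∩ τ).Nonempty := by
    intro σ hσ h2 hσM
    have hσ2 : #σ = 2 := by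
      have hσ3 : #σ ≠ 3 := fun h => hσM (hTM (mem_triangles.2 ⟨mem_faces_of_mem_facets hσ, h⟩))
      have hle := hΓ σ (mem_faces_of_mem_facets hσ)
      omega
    refine ⟨hσ2, fun τ hτ hne => hstuck σ (mem_filter.2 ⟨hσ, h2⟩) ?_⟩
    refine attaches_of_card_eq_two hσ2 (fun ρ hρ hσρ => hσM ?_) ⟨τ, hτ, hne⟩
    rwa [eq_of_mem_facets_of_subset hσ (mem_faces_of_mem_facets (hMfacet ρ hρ).1) hσρ]
  obtain ⟨σ, hσ, hσM⟩ := exists_of_ssubset hM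
  obtain ⟨hσ, hσ2⟩ := mem_filter.1 hσ
  obtain ⟨hcard, hmiss⟩ := misses σ hσ hσ2 hσM
  obtain rfl | ⟨τ, hτ⟩ := M.eq_empty_or_nonempty
  · exact hstuck σ (mem_filter.2 ⟨hσ, hσ2⟩) (attaches_empty σ)
  obtain ⟨a, ha, b, hb, hab⟩ := one_lt_card.1 (hMfacet τ hτ).2
  obtain ⟨c, d, hcd, rfl⟩ := card_eq_two.1 hcard
  refine hG a b c d ⟨hab, hcd, pair_mem_faces (mem_faces_of_mem_facets (hMfacet τ hτ).1) ha hb,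
    mem_faces_of_mem_facets hσ, fun x hx y hy hxy => ?_⟩
  have hxτ : x ∈ τ := by
    rw [mem_insert, mem_singleton] at hx
    obtain rfl | rfl := hx <;> assumption
  have hne : x ≠ y := by
    rintro rfl
    exact hmiss τ hτ ⟨x, mem_inter.2 ⟨hy, hxτ⟩⟩
  obtain ⟨ρ, hρ, hxyρ⟩ := exists_mem_facets_superset hxy
  obtain ⟨hxρ, hyρ⟩ := insert_subset_iff.1 hxyρ
  rw [singleton_subset_iff] at hyρ
  by_cases hρM : ρ ∈ M
  · exact hmiss ρ hρM ⟨y, mem_inter.2 ⟨hy, hyρ⟩⟩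
  · exact (misses ρ hρ (one_lt_card.2 ⟨x, hxρ, y, hyρ, hne⟩) hρM).2 τ hτ
      ⟨x, mem_inter.2 ⟨hxρ, hxτ⟩⟩

theorem isShellable_of_shelled_triangles (hΓ : ∀ s ∈ Γ.faces, #s ≤ 3) (hG : Γ.TwoK2Free)
    (hT : Shelled Γ.triangles) : Γ.IsShellable := by
  rw [isShellable_iff_shelled_facets]
  refine (shelled_filter_two_le_card hΓ hG hT).of_forall_exists_attaches (filter_subset _ _)
    fun M hsub hM => ?_
  obtain ⟨σ, hσ, hσM⟩ := exists_of_ssubset hM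
  refine ⟨σ, hσ, ?_⟩
  have hnsub : ∀ τ ∈ M, ¬ σ ⊆ τ := fun τ hτ hστ =>
    hσM (eq_of_mem_facets_of_subset hσ (mem_faces_of_mem_facets (hM.1 hτ)) hστ ▸ hτ)
  have hcard : #σ ≤ 1 := by
    by_contra hcard
    exact hσM (hsub (mem_filter.2 ⟨hσ, by omega⟩))
  obtain h0 | h1 := Nat.le_one_iff_eq_zero_or_eq_one.1 hcard
  · obtain rfl := card_eq_zero.1 h0
    exact fun τ hτ => absurd (empty_subset τ) (hnsub τ hτ)
  · obtain ⟨x, rfl⟩ := card_eq_one.1 h1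
    exact attaches_singleton fun τ hτ => by simpa using hnsub τ hτ

/-- The first member of a shelling attaches to nothing, but the second one attaches to it. -/
theorem Shelled.exists_adjacent {S : Finset (Finset E)} (h : Shelled S) {σ τ : Finset E}
    (hσ : σ ∈ S) (hτ : τ ∈ S) (hne : σ ≠ τ) :
    ∃ ρ ∈ S, ρ ≠ σ ∧ (#(σ ∩ ρ) + 1 = #σ ∨ #(σ ∩ ρ) + 1 = #ρ) := by
  induction h generalizing τ with
  | empty => exact absurd hσ (notMem_empty σ)
  | @attach S σ₀ _ ha ih =>
    by_cases hσS : σ ∈ S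
    · by_cases hother : ∃ τ ∈ S, σ ≠ τ
      · obtain ⟨τ', hτ', hne'⟩ := hother
        obtain ⟨ρ, hρ, hadj⟩ := ih hσS hτ' hne'
        exact ⟨ρ, mem_insert_of_mem hρ, hadj⟩
      · push Not at hother
        obtain ⟨ρ, hρ, -, hcard⟩ := ha σ hσS
        rw [← hother ρ hρ, inter_comm] at hcard
        exact ⟨σ₀, mem_insert_self _ _, fun h => ha.notMem (h ▸ hσS), Or.inr hcard⟩
    · obtain rfl := (mem_insert.1 hσ).resolve_right hσS
      obtain ⟨ρ, hρ, -, hcard⟩ := ha τ ((mem_insert.1 hτ).resolve_left hne.symm)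
      exact ⟨ρ, mem_insert_of_mem hρ, fun h => ha.notMem (h ▸ hρ), Or.inl hcard⟩

theorem not_shelled_pair_of_disjoint {σ τ : Finset E} (hσ : 2 ≤ #σ) (hτ : 2 ≤ #τ)
    (hd : Disjoint σ τ) : ¬ Shelled {σ, τ} := by
  intro h
  have hne : σ ≠ τ := fun h => by
    rw [← h, disjoint_self_iff_empty] at hd
    simp [hd] at hσ
  obtain ⟨ρ, hρ, hρσ, hcard⟩ := h.exists_adjacent (mem_insert_self _ _)
    (mem_insert_of_mem (mem_singleton_self _)) hne
  obtain rfl := mem_singleton.1 ((mem_insert.1 hρ).resolve_left hρσ)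
  rw [disjoint_iff_inter_eq_empty.1 hd, card_empty] at hcard
  omega

theorem IsInducedTwoK2.not_isShellable_restrict (h : Γ.IsInducedTwoK2 a b c d) :
    ¬ (Γ.restrict ({a, b} ∪ {c, d})).IsShellable := by
  have hab := card_pair h.left_ne
  have hcd := card_pair h.right_ne
  have hnsub : ∀ {σ τ : Finset E}, #σ = 2 → Disjoint σ τ → ¬ σ ⊆ τ := fun hσ hd hsub => by
    rw [hd.eq_bot_of_le hsub] at hσ
    simp at hσ
  rw [isShellable_iff_shelled_facets, facets_eq_pair
    (mem_restrict.2 ⟨h.left_mem, subset_union_left⟩)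
    (mem_restrict.2 ⟨h.right_mem, subset_union_right⟩) (hnsub hab h.disjoint)
    (hnsub hcd h.disjoint.symm) fun s hs => h.subset_or_subset hs]
  exact not_shelled_pair_of_disjoint hab.ge hcd.ge h.disjoint

theorem IsObstruction.vertexSet_eq_of_isInducedTwoK2 (hΓ : Γ.IsObstruction)
    (h : Γ.IsInducedTwoK2 a b c d) : Γ.vertexSet = ({a, b} ∪ {c, d} : Finset E) := by
  have hsub : (({a, b} ∪ {c, d} : Finset E) : Set E) ⊆ Γ.vertexSet := by
    intro x hx
    obtain hx | hx := mem_union.1 (mem_coe.1 hx)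
    exacts [mem_vertexSet_of_mem h.left_mem hx, mem_vertexSet_of_mem h.right_mem hx]
  by_contra hne
  exact h.not_isShellable_restrict (hΓ.2 _ (hsub.ssubset_of_ne (Ne.symm hne)))

theorem restrict_eq_self {W : Finset E} (hW : Γ.vertexSet ⊆ W) : Γ.restrict W = Γ := by
  ext s
  rw [mem_restrict]
  exact and_iff_left_of_imp fun hs x hx => hW (mem_vertexSet_of_mem hs hx)

theorem IsObstruction.twoK2Free (hΓ : Γ.IsObstruction) (hd : Γ.dim = 2) : Γ.TwoK2Free := by
  intro a b c d h
  obtain ⟨-, s, hs⟩ := dim_eq_two_iff.1 hd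
  rw [mem_triangles, ← restrict_eq_self (hΓ.vertexSet_eq_of_isInducedTwoK2 h).subset] at hs
  have hab := card_pair h.left_ne
  have hcd := card_pair h.right_ne
  obtain hsub | hsub := h.subset_or_subset hs.1 <;> have := card_le_card hsub <;> omega

theorem IsObstruction.shelled_filter_triangles (hΓ : Γ.IsObstruction)
    (hcard : ∀ s ∈ Γ.faces, #s ≤ 3) {v : E} (hv : v ∈ Γ.vertexSet) {W : Finset E} (hvW : v ∉ W) :
    Shelled {σ ∈ Γ.triangles | σ ⊆ W} := by
  let W' : Finset E := {x ∈ W | {x} ∈ Γ.faces}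
  have hsub : (W' : Set E) ⊆ Γ.vertexSet := fun x hx => (mem_filter.1 (mem_coe.1 hx)).2
  have hW' : (W' : Set E) ⊂ Γ.vertexSet :=
    (Set.ssubset_iff_of_subset hsub).2 ⟨v, hv, fun h => hvW (mem_of_mem_filter v h)⟩
  have hs := shelled_triangles (fun s hs => hcard s (mem_restrict.1 hs).1) (hΓ.2 W' hW')
  rw [triangles_restrict] at hs
  convert hs using 1
  refine filter_congr fun s hs => ⟨fun hsW x hx => mem_filter.2 ⟨hsW hx, ?_⟩,
    fun hsW => hsW.trans (filter_subset _ _)⟩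
  exact mem_vertexSet_of_mem (mem_triangles.1 hs).1 hx

/-- A family of 3-sets that is not shelled although all its proper restrictions are: the triangles
of a 2-dimensional obstruction. -/
structure Critical (T : Finset (Finset E)) : Prop where
  sized : (T : Set (Finset E)).Sized 3
  not_shelled : ¬ Shelled T
  shelled_restrict : ∀ W : Finset E, (∃ σ ∈ T, ¬ σ ⊆ W) → Shelled {σ ∈ T | σ ⊆ W}

theorem Critical.nonempty {T : Finset (Finset E)} (h : Critical T) : T.Nonempty :=
  nonempty_iff_ne_empty.2 fun he => h.not_shelled (he ▸ Shelled.empty)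

theorem isObstruction_iff_of_dim_eq_two (hd : Γ.dim = 2) :
    Γ.IsObstruction ↔ Γ.TwoK2Free ∧ Critical Γ.triangles ∧
      ∀ v ∈ Γ.vertexSet, ∃ σ ∈ Γ.triangles, v ∈ σ := by
  have hcard := (dim_eq_two_iff.1 hd).1
  constructor
  · intro hΓ
    have hG := hΓ.twoK2Free hd
    have hT : ¬ Shelled Γ.triangles := fun h =>
      hΓ.1 (isShellable_of_shelled_triangles hcard hG h)
    refine ⟨hG, ⟨sized_triangles, hT, ?_⟩, fun v hv => ?_⟩
    · rintro W ⟨σ, hσ, hσW⟩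
      obtain ⟨x, hx, hxW⟩ := not_subset.1 hσW
      exact hΓ.shelled_filter_triangles hcard
        (mem_vertexSet_of_mem (mem_triangles.1 hσ).1 hx) hxW
    · by_contra! hv'
      have hs := hΓ.shelled_filter_triangles hcard hv (notMem_erase v (Γ.triangles.biUnion id))
      rw [filter_true_of_mem] at hs
      · exact hT hs
      · exact fun σ hσ => subset_erase.2 ⟨subset_biUnion_of_mem id hσ, hv' σ hσ⟩
  · rintro ⟨hG, hT, hcov⟩
    refine ⟨fun h => hT.not_shelled (shelled_triangles hcard h), fun W hW => ?_⟩
    refine isShellable_of_shelled_triangles (fun s hs => hcard s (mem_restrict.1 hs).1)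
      (hG.restrict W) ?_
    obtain ⟨v, hv, hvW⟩ := Set.exists_of_ssubset hW
    obtain ⟨σ, hσ, hvσ⟩ := hcov v hv
    rw [triangles_restrict]
    exact hT.shelled_restrict W ⟨σ, hσ, fun h => hvW (h hvσ)⟩

end Obstruction

section Connectivity

variable {E : Type*} [DecidableEq E] {S : Finset (Finset E)}

/-- The link of every face of codimension at least two is connected, in the form that a function on
the vertices which is constant on each member of the link is constant. -/
theorem Shelled.link_connected {α : Type*} {f : E → α} {ρ : Finset E} (h : Shelled S)
    (hcard : ∀ σ ∈ S, ρ ⊆ σ → #ρ + 2 ≤ #σ)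
    (hf : ∀ σ ∈ S, ρ ⊆ σ → ∀ x ∈ σ \ ρ, ∀ y ∈ σ \ ρ, f x = f y) :
    ∀ σ ∈ S, ρ ⊆ σ → ∀ τ ∈ S, ρ ⊆ τ → ∀ x ∈ σ \ ρ, ∀ y ∈ τ \ ρ, f x = f y := by
  induction h with
  | empty => exact fun σ hσ => absurd hσ (notMem_empty σ)
  | @attach S σ₀ _ ha ih =>
    rw [forall_mem_insert] at hcard hf
    have ih := ih hcard.2 hf.2
    have bridge : ρ ⊆ σ₀ → ∀ τ ∈ S, ρ ⊆ τ → ∀ x ∈ σ₀ \ ρ, ∀ y ∈ τ \ ρ, f x = f y := by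
      intro hρ τ hτ hρτ x hx y hy
      obtain ⟨τ', hτ', hsub, hcard'⟩ := ha τ hτ
      obtain ⟨w, hw, hwρ⟩ : ∃ w ∈ σ₀ ∩ τ', w ∉ ρ := exists_mem_notMem_of_card_lt_card (by
        have := hcard.1 hρ
        omega)
      obtain ⟨hwσ₀, hwτ'⟩ := mem_inter.1 hw
      exact (hf.1 hρ x hx w (mem_sdiff.2 ⟨hwσ₀, hwρ⟩)).trans <|
        ih τ' hτ' ((subset_inter hρ hρτ).trans hsub) τ hτ hρτ w (mem_sdiff.2 ⟨hwτ', hwρ⟩) y hy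
    intro σ hσ hρσ τ hτ hρτ x hx y hy
    obtain rfl | hσS := mem_insert.1 hσ <;> obtain rfl | hτS := mem_insert.1 hτ
    · exact hf.1 hρσ x hx y hy
    · exact bridge hρσ τ hτS hρτ x hx y hy
    · exact (bridge hρτ σ hσS hρσ y hy x hx).symm
    · exact ih σ hσS hρσ τ hτS hρτ x hx y hy

theorem Shelled.connected {α : Type*} {f : E → α} (h : Shelled S) (hcard : ∀ σ ∈ S, 2 ≤ #σ)
    (hf : ∀ σ ∈ S, ∀ x ∈ σ, ∀ y ∈ σ, f x = f y) {σ τ : Finset E} (hσ : σ ∈ S) (hτ : τ ∈ S)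
    {x y : E} (hx : x ∈ σ) (hy : y ∈ τ) : f x = f y := by
  refine h.link_connected (ρ := ∅) (fun σ hσ _ => by simpa using hcard σ hσ)
    (fun σ hσ _ => ?_) σ hσ (empty_subset σ) τ hτ (empty_subset τ) x (by simpa) y (by simpa)
  simpa only [sdiff_empty] using hf σ hσ

variable {A : Type*} [AddCommGroup A] {φ : E → E → A}

/-- The members of `S` that meet `σ` in codimension one cover `σ ∩ ⋃ S` by sets which pairwise
intersect, so that a potential on `S` differs from one on `σ` by a single constant. -/
theorem Attaches.exists_potential {σ : Finset E} (ha : Attaches S σ) (hcard : 3 ≤ #σ)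
    (hφ : ∀ x ∈ σ, ∀ y ∈ σ, ∀ z ∈ σ, φ x y + φ y z = φ x z) {g : E → A}
    (hg : ∀ τ ∈ S, ∀ x ∈ τ, ∀ y ∈ τ, φ x y = g y - g x) :
    ∃ g' : E → A, (∀ τ ∈ S, ∀ x ∈ τ, ∀ y ∈ τ, φ x y = g' y - g' x) ∧
      ∃ x ∈ σ, ∀ y ∈ σ, φ x y = g' y - g' x := by
  obtain rfl | ⟨τ, hτ⟩ := S.eq_empty_or_nonempty
  · obtain ⟨x, hx⟩ := card_pos.1 (by omega : 0 < #σ)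
    have hxx : φ x x = 0 := by simpa using hφ x hx x hx x hx
    exact ⟨φ x, by simp, x, hx, by simp [hxx]⟩
  obtain ⟨τ', hτ', -, hcard'⟩ := ha τ hτ
  obtain ⟨z, hz⟩ := card_eq_one.1 (by have := card_sdiff_add_card_inter σ τ'; omega : #(σ \ τ') = 1)
  have hzσ : z ∈ σ \ τ' := hz ▸ mem_singleton_self z
  have eq_or_mem : ∀ y ∈ σ, y = z ∨ y ∈ τ' := fun y hy => or_iff_not_imp_right.2 fun hyτ =>
    mem_singleton.1 (hz ▸ mem_sdiff.2 ⟨hy, hyτ⟩)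
  by_cases hzS : ∃ τ₁ ∈ S, z ∈ τ₁
  · obtain ⟨τ₁, hτ₁, hzτ₁⟩ := hzS
    obtain ⟨τ₂, hτ₂, hsub, hcard₂⟩ := ha τ₁ hτ₁
    have hzτ₂ : z ∈ τ₂ := hsub (mem_inter.2 ⟨(mem_sdiff.1 hzσ).1, hzτ₁⟩)
    obtain ⟨x, hx⟩ : ((σ ∩ τ') ∩ (σ ∩ τ₂)).Nonempty := by
      refine inter_nonempty_of_card_lt_card_add_card inter_subset_left inter_subset_left ?_
      omega
    simp only [mem_inter] at hx
    refine ⟨g, hg, x, hx.1.1, fun y hy => ?_⟩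
    obtain rfl | hyτ' := eq_or_mem y hy
    exacts [hg τ₂ hτ₂ x hx.2.2 y hzτ₂, hg τ' hτ' x hx.1.2 y hyτ']
  · push Not at hzS
    obtain ⟨x, hx⟩ := card_pos.1 (by omega : 0 < #(σ ∩ τ'))
    obtain ⟨hxσ, hxτ'⟩ := mem_inter.1 hx
    have update_of_mem : ∀ τ ∈ S, ∀ y ∈ τ,
        Function.update g z (g x + φ x z) y = g y := fun τ hτ y hy =>
      Function.update_of_ne (by rintro rfl; exact hzS τ hτ hy) _ _
    refine ⟨Function.update g z (g x + φ x z), fun τ hτ p hp q hq => ?_, x, hxσ, fun y hy => ?_⟩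
    · rw [update_of_mem τ hτ p hp, update_of_mem τ hτ q hq, hg τ hτ p hp q hq]
    · rw [update_of_mem τ' hτ' x hxτ']
      obtain rfl | hyτ' := eq_or_mem y hy
      · rw [Function.update_self, add_sub_cancel_left]
      · rw [update_of_mem τ' hτ' y hyτ', hg τ' hτ' x hxτ' y hyτ']

/-- A one-cocycle on a shelled family of sets of dimension at least two is a coboundary. -/
theorem Shelled.exists_potential (h : Shelled S) (hcard : ∀ σ ∈ S, 3 ≤ #σ)
    (hφ : ∀ σ ∈ S, ∀ x ∈ σ, ∀ y ∈ σ, ∀ z ∈ σ, φ x y + φ y z = φ x z) :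
    ∃ f : E → A, ∀ σ ∈ S, ∀ x ∈ σ, ∀ y ∈ σ, φ x y = f y - f x := by
  induction h with
  | empty => exact ⟨0, fun σ hσ => absurd hσ (notMem_empty σ)⟩
  | @attach S σ _ ha ih =>
    rw [forall_mem_insert] at hcard hφ
    obtain ⟨g, hg⟩ := ih hcard.2 hφ.2
    obtain ⟨g', hg', x, hx, hxg'⟩ := ha.exists_potential hcard.1 hφ.1 hg
    refine ⟨g', (forall_mem_insert _ _ _).2 ⟨fun p hp q hq => ?_, hg'⟩⟩
    rw [← add_right_inj (φ x p), hφ.1 x hx p hp q hq, hxg' p hp, hxg' q hq]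
    abel

end Connectivity

section Sep

variable {E : Type*} [DecidableEq E] {T : Finset (Finset E)} {v a b c x y z : E}

/-- `abc` is a triangle of `T`; thus `Tri T v` is the adjacency relation of the link of `v`. -/
def Tri (T : Finset (Finset E)) (a b c : E) : Prop := {a, b, c} ∈ T

theorem Tri.swap (h : Tri T a b c) : Tri T b a c := by rwa [Tri, insert_comm]

theorem Tri.swap' (h : Tri T a b c) : Tri T a c b := by rwa [Tri, pair_comm]

theorem Tri.rot (h : Tri T a b c) : Tri T b c a := h.swap.swap'

theorem Tri.rot' (h : Tri T a b c) : Tri T c a b := h.swap'.swap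

theorem Tri.rev (h : Tri T a b c) : Tri T c b a := h.rot.swap

theorem Tri.ne (h : Tri T a b c) (hT : (T : Set (Finset E)).Sized 3) : a ≠ b ∧ a ≠ c ∧ b ≠ c :=
  card_triple_eq_three_iff.1 (hT h)

theorem exists_tri_of_mem (hT : (T : Set (Finset E)).Sized 3) {σ : Finset E} (hσ : σ ∈ T)
    (hx : x ∈ σ) : ∃ y z, Tri T x y z ∧ σ = {x, y, z} := by
  obtain ⟨y, z, -, h⟩ := card_eq_two.1 ((card_erase_of_mem hx).trans (by rw [hT hσ]))
  obtain rfl : σ = {x, y, z} := by rw [← h, insert_erase hx]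
  exact ⟨y, z, hσ, rfl⟩

theorem exists_tri_of_mem_of_mem (hT : (T : Set (Finset E)).Sized 3) {σ : Finset E} (hσ : σ ∈ T)
    (hx : x ∈ σ) (hy : y ∈ σ) (hxy : x ≠ y) : ∃ z, Tri T x y z ∧ σ = {x, y, z} := by
  obtain ⟨p, q, hpq, rfl⟩ := exists_tri_of_mem hT hσ hx
  simp only [mem_insert, mem_singleton] at hy
  obtain rfl | rfl | rfl := hy
  exacts [absurd rfl hxy, ⟨q, hpq, rfl⟩, ⟨p, hpq.swap', by rw [pair_comm]⟩]

theorem tri_of_mem (hT : (T : Set (Finset E)).Sized 3) {σ : Finset E} (hσ : σ ∈ T) (hx : x ∈ σ)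
    (hy : y ∈ σ) (hz : z ∈ σ) (hxy : x ≠ y) (hxz : x ≠ z) (hyz : y ≠ z) : Tri T x y z := by
  have hsub : {x, y, z} ⊆ σ :=
    insert_subset hx (insert_subset hy (singleton_subset_iff.2 hz))
  have hcard : #{x, y, z} = 3 := card_triple_eq_three_iff.2 ⟨hxy, hxz, hyz⟩
  rwa [Tri, eq_of_subset_of_card_le hsub (by rw [hT hσ, hcard])]

/-- The edge `xy` lies in a triangle avoiding `v`. -/
def Covered (T : Finset (Finset E)) (v x y : E) : Prop := ∃ z, z ≠ v ∧ Tri T x y z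

theorem Covered.symm (h : Covered T v x y) : Covered T v y x :=
  h.imp fun _ => And.imp_right Tri.swap

theorem covered_of_mem (hT : (T : Set (Finset E)).Sized 3) {σ : Finset E} (hσ : σ ∈ T) (hv : v ∉ σ)
    (hx : x ∈ σ) (hy : y ∈ σ) (hxy : x ≠ y) : Covered T v x y := by
  obtain ⟨z, hxyz, rfl⟩ := exists_tri_of_mem_of_mem hT hσ hx hy hxy
  refine ⟨z, ?_, hxyz⟩
  rintro rfl
  simp at hv

/-- Covered edges do not connect `a` and `b` in the link of `v`, as witnessed by a union of
components containing `a` but not `b`. -/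
def Sep (T : Finset (Finset E)) (v a b : E) : Prop :=
  ∃ A : Set E, a ∈ A ∧ b ∉ A ∧ ∀ x y, Tri T v x y → Covered T v x y → (x ∈ A ↔ y ∈ A)

theorem Sep.symm (h : Sep T v a b) : Sep T v b a := by
  obtain ⟨A, ha, hb, hA⟩ := h
  exact ⟨Aᶜ, hb, not_not_intro ha, fun x y hxy hc => not_congr (hA x y hxy hc)⟩

theorem Sep.trans_right (h : Sep T v a b) (hbc : Tri T v b c) (hc : Covered T v b c) :
    Sep T v a c := by
  obtain ⟨A, ha, hb, hA⟩ := h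
  exact ⟨A, ha, fun h => hb ((hA b c hbc hc).2 h), hA⟩

theorem Sep.ne (h : Sep T v a b) : a ≠ b := by
  obtain ⟨A, ha, hb, -⟩ := h
  exact ne_of_mem_of_not_mem ha hb

theorem Sep.mono {S : Finset (Finset E)} (hST : S ⊆ T) (h : Sep T v a b) : Sep S v a b := by
  obtain ⟨A, ha, hb, hA⟩ := h
  exact ⟨A, ha, hb, fun x y hxy ⟨z, hz, hxyz⟩ => hA x y (hST hxy) ⟨z, hz, hST hxyz⟩⟩

theorem Sep.not_covered (h : Sep T v a b) (hab : Tri T v a b) : ¬ Covered T v a b := by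
  obtain ⟨A, ha, hb, hA⟩ := h
  exact fun hc => hb ((hA a b hab hc).1 ha)

theorem Sep.eq_of_tri (h : Sep T v a b) (hab : Tri T v a b) (habc : Tri T a b c) : c = v :=
  of_not_not fun hc => h.not_covered hab ⟨c, hc, habc⟩

/-- The coboundary of the indicator function of a separating set, extended by zero from the
triangles through `v` to the others. -/
theorem Sep.exists_cocycle (hT : (T : Set (Finset E)).Sized 3) (h : Sep T v a b) :
    ∃ (g : E → ℤ) (φ : E → E → ℤ), g a ≠ g b ∧
      (∀ σ ∈ T, v ∈ σ → ∀ x ∈ σ, ∀ y ∈ σ, φ x y = g y - g x) ∧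
      ∀ σ ∈ T, v ∉ σ → ∀ x ∈ σ, ∀ y ∈ σ, φ x y = 0 := by
  classical
  obtain ⟨A, ha, hb, hA⟩ := h
  let g : E → ℤ := A.indicator 1
  refine ⟨g, fun x y => if ∃ τ ∈ T, v ∉ τ ∧ x ∈ τ ∧ y ∈ τ then 0 else g y - g x,
    by simp [g, ha, hb], fun σ hσ hvσ x hx y hy => ite_eq_right_iff.2 ?_,
    fun σ hσ hvσ x hx y hy => if_pos ⟨σ, hσ, hvσ, hx, hy⟩⟩
  rintro ⟨τ, hτ, hvτ, hxτ, hyτ⟩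
  obtain rfl | hxy := eq_or_ne x y
  · exact (sub_self _).symm
  have hvxy : Tri T v x y := tri_of_mem hT hσ hvσ hx hy
    (ne_of_mem_of_not_mem hxτ hvτ).symm (ne_of_mem_of_not_mem hyτ hvτ).symm hxy
  have hxyA := hA x y hvxy (covered_of_mem hT hτ hvτ hxτ hyτ hxy)
  simp only [g, Set.indicator, hxyA, Pi.one_apply, sub_self]

/-- The deletion of `v` is connected, so a potential for the above cocycle would not tell `a` from
`b`. -/
theorem not_shelled_of_sep (hT : (T : Set (Finset E)).Sized 3) (hv : Shelled {σ ∈ T | v ∉ σ})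
    (hab : Tri T v a b) (hs : Sep T v a b) (ha : ∃ σ ∈ T, v ∉ σ ∧ a ∈ σ)
    (hb : ∃ σ ∈ T, v ∉ σ ∧ b ∈ σ) : ¬ Shelled T := by
  intro h
  obtain ⟨g, φ, hgab, φ_of_mem, φ_of_notMem⟩ := hs.exists_cocycle hT
  have cocycle : ∀ σ ∈ T, ∀ x ∈ σ, ∀ y ∈ σ, ∀ z ∈ σ, φ x y + φ y z = φ x z := by
    intro σ hσ x hx y hy z hz
    by_cases hvσ : v ∈ σ
    · rw [φ_of_mem σ hσ hvσ x hx y hy, φ_of_mem σ hσ hvσ y hy z hz, φ_of_mem σ hσ hvσ x hx z hz]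
      abel
    · rw [φ_of_notMem σ hσ hvσ x hx y hy, φ_of_notMem σ hσ hvσ y hy z hz,
        φ_of_notMem σ hσ hvσ x hx z hz, add_zero]
  obtain ⟨f, hf⟩ := h.exists_potential (fun σ hσ => (hT hσ).ge) cocycle
  have hfab : f a = f b := by
    obtain ⟨σ, hσ, hvσ, haσ⟩ := ha
    obtain ⟨τ, hτ, hvτ, hbτ⟩ := hb
    refine hv.connected (fun ρ hρ => ?_) (fun ρ hρ x hx y hy => ?_)
      (mem_filter.2 ⟨hσ, hvσ⟩) (mem_filter.2 ⟨hτ, hvτ⟩) haσ hbτ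
    · rw [hT (mem_filter.1 hρ).1]
      norm_num
    · obtain ⟨hρ, hvρ⟩ := mem_filter.1 hρ
      rw [← sub_eq_zero, ← hf ρ hρ y hy x hx, φ_of_notMem ρ hρ hvρ y hy x hx]
  have hba := φ_of_mem _ hab (by simp) b (by simp) a (by simp)
  rw [hf _ hab b (by simp) a (by simp), hfab, sub_self] at hba
  exact hgab (sub_eq_zero.1 hba.symm)

/-- The links of the vertices have no induced `2K₂`. -/
def LinksTwoK2Free (T : Finset (Finset E)) : Prop :=
  ∀ u a b c d : E, Tri T u a b → Tri T u c d → a ≠ c → a ≠ d → b ≠ c → b ≠ d →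
    Tri T u a c ∨ Tri T u a d ∨ Tri T u b c ∨ Tri T u b d

end Sep

section Critical

variable {E : Type*} [DecidableEq E] {T S : Finset (Finset E)} {v a b c d u x y : E}
  {σ τ : Finset E}

theorem tri_or_of_sep (hL : LinksTwoK2Free T) (hab : Tri T v a b) (hs : Sep T v a b)
    (hx : Tri T a x y) (hvx : v ≠ x) (hvy : v ≠ y) : Tri T v a x ∨ Tri T v a y := by
  have hbx : b ≠ x := by
    rintro rfl
    exact hvy (hs.eq_of_tri hab hx).symm
  have hby : b ≠ y := by
    rintro rfl
    exact hvx (hs.eq_of_tri hab hx.swap').symm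
  rcases hL a v b x y hab.swap hx hvx hvy hbx hby with h | h | h | h
  exacts [.inl h.swap, .inr h.swap, absurd (hs.eq_of_tri hab h).symm hvx,
    absurd (hs.eq_of_tri hab h).symm hvy]

theorem disjoint_of_forall_not_covered (hT : (T : Set (Finset E)).Sized 3)
    (hL : LinksTwoK2Free T) (hcov : ∀ x y, Tri T v x y → ¬ Covered T v x y)
    (hσ : σ ∈ T) (hvσ : v ∈ σ) (hτ : τ ∈ T) (hvτ : v ∉ τ) : Disjoint σ τ := by
  rw [disjoint_left]
  intro x hxσ hxτ
  obtain ⟨y, hvxy, -⟩ := exists_tri_of_mem_of_mem hT hσ hvσ hxσ (ne_of_mem_of_not_mem hxτ hvτ).symm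
  obtain ⟨q, r, hxqr, rfl⟩ := exists_tri_of_mem hT hτ hxτ
  obtain ⟨hxq, hxr, -⟩ := hxqr.ne hT
  have hcovτ := fun {s t : E} => covered_of_mem hT (x := s) (y := t) hτ hvτ
  simp only [mem_insert, mem_singleton, not_or] at hvτ hcovτ
  have hyq : y ≠ q := by
    rintro rfl
    exact hcov x y hvxy (hcovτ (by simp) (by simp) hxq)
  have hyr : y ≠ r := by
    rintro rfl
    exact hcov x y hvxy (hcovτ (by simp) (by simp) hxr)
  rcases hL x v y q r hvxy.swap hxqr hvτ.2.1 hvτ.2.2 hyq hyr with h | h | h | h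
  · exact hcov x q h.swap (hcovτ (by simp) (by simp) hxq)
  · exact hcov x r h.swap (hcovτ (by simp) (by simp) hxr)
  · exact hcov x y hvxy ⟨q, Ne.symm hvτ.2.1, h⟩
  · exact hcov x y hvxy ⟨r, Ne.symm hvτ.2.2, h⟩

/-- `T` consists of two disjoint sets. -/
def TwoDisjoint (T : Finset (Finset E)) : Prop := ∃ σ τ, Disjoint σ τ ∧ T = {σ, τ}

/-- `S` is an extension of the deletion of `v`, to which no member of `T` attaches. -/
structure IsStuck (T : Finset (Finset E)) (v : E) (S : Finset (Finset E)) : Prop where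
  mem_of_notMem : ∀ σ ∈ T, v ∉ σ → σ ∈ S
  ssubset : S ⊂ T
  not_attaches : ∀ σ ∈ T, ¬ Attaches S σ

theorem IsStuck.sized (hT : (T : Set (Finset E)).Sized 3) (hS : IsStuck T v S) :
    (S : Set (Finset E)).Sized 3 := fun _ hσ => hT (hS.ssubset.1 hσ)

/-- A triangle `vxy` with `vx` an edge of `S` would attach along `vx` if `y` were new or `vy` were
an edge of `S`, and along `xy` if that were an edge of `S`. -/
theorem IsStuck.of_tri (hT : (T : Set (Finset E)).Sized 3) (hS : IsStuck T v S)
    (hxy : Tri T v x y) (hnew : ¬ Tri S v x y) (hx : ∃ τ ∈ S, v ∈ τ ∧ x ∈ τ) :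
    (∃ τ ∈ S, y ∈ τ) ∧ (∀ τ ∈ S, v ∈ τ → y ∉ τ) ∧ ∀ τ ∈ S, x ∈ τ → y ∉ τ := by
  have hnew' : ¬ Tri S x y v := fun h => hnew h.rot'
  have h1 : ¬ ((∀ τ ∈ S, y ∉ τ) ∨ ∃ τ ∈ S, v ∈ τ ∧ y ∈ τ) := fun h =>
    hS.not_attaches _ hxy (attaches_triple (hS.sized hT) (hT hxy) hnew hx h)
  have h2 : ¬ ∃ τ ∈ S, x ∈ τ ∧ y ∈ τ := fun h => hS.not_attaches _ hxy.rot
    (attaches_triple (hS.sized hT) (hT hxy.rot) hnew' h (.inr (hx.imp fun _ => by tauto)))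
  push Not at h1 h2
  exact ⟨h1.1, h1.2, h2⟩

theorem IsStuck.mem_star_iff (hT : (T : Set (Finset E)).Sized 3) (hS : IsStuck T v S)
    (hxy : Tri T v x y) (hcov : Covered T v x y) :
    (∃ τ ∈ S, v ∈ τ ∧ x ∈ τ) ↔ ∃ τ ∈ S, v ∈ τ ∧ y ∈ τ := by
  have mem_star : ∀ {x y}, Tri T v x y → Covered T v x y → (∃ τ ∈ S, v ∈ τ ∧ x ∈ τ) →
      ∃ τ ∈ S, v ∈ τ ∧ y ∈ τ := by
    rintro x y hxy ⟨z, hz, hxyz⟩ hx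
    by_contra hy
    obtain ⟨hvx, hvy, -⟩ := hxy.ne hT
    have hnew : ¬ Tri S v x y := fun h => hy ⟨_, h, by simp⟩
    exact (hS.of_tri hT hxy hnew hx).2.2 _ (hS.mem_of_notMem _ hxyz (by simp [hvx, hvy, hz.symm]))
      (by simp) (by simp)
  exact ⟨mem_star hxy hcov, mem_star hxy.swap' hcov.symm⟩

theorem IsStuck.sep (hT : (T : Set (Finset E)).Sized 3) (hS : IsStuck T v S)
    (ha : ∃ τ ∈ S, v ∈ τ ∧ a ∈ τ) (hb : ¬ ∃ τ ∈ S, v ∈ τ ∧ b ∈ τ) : Sep T v a b :=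
  ⟨{x | ∃ τ ∈ S, v ∈ τ ∧ x ∈ τ}, ha, hb, fun _ _ hxy hcov => hS.mem_star_iff hT hxy hcov⟩

theorem IsStuck.exists_tri (hT : (T : Set (Finset E)).Sized 3) (hL : LinksTwoK2Free T)
    (hS : IsStuck T v S) (hv : ∃ τ ∈ S, v ∈ τ) :
    ∃ a b, Tri T v a b ∧ a ≠ v ∧ (∃ τ ∈ S, v ∈ τ ∧ a ∈ τ) ∧ ¬ ∃ τ ∈ S, v ∈ τ ∧ b ∈ τ := by
  obtain ⟨τ, hτ, hvτ⟩ := hv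
  obtain ⟨c, d, hcd, rfl⟩ := exists_tri_of_mem (hS.sized hT) hτ hvτ
  obtain ⟨σ, hσ, hσS⟩ := exists_of_ssubset hS.ssubset
  have hvσ : v ∈ σ := by_contra fun h => hσS (hS.mem_of_notMem σ hσ h)
  obtain ⟨x, y, hxy, rfl⟩ := exists_tri_of_mem hT hσ hvσ
  have hc : ∃ τ ∈ S, v ∈ τ ∧ c ∈ τ := ⟨_, hcd, by simp⟩
  have hd : ∃ τ ∈ S, v ∈ τ ∧ d ∈ τ := ⟨_, hcd, by simp⟩
  have not_star : ∀ {x y}, Tri T v x y → ¬ Tri S v x y → (∃ τ ∈ S, v ∈ τ ∧ x ∈ τ) →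
      ¬ ∃ τ ∈ S, v ∈ τ ∧ y ∈ τ := fun hxy hnew hx ⟨τ, hτ, hvτ, hyτ⟩ =>
    (hS.of_tri hT hxy hnew hx).2.1 τ hτ hvτ hyτ
  have of_star : ∀ {a b}, Tri T v a b → (∃ τ ∈ S, v ∈ τ ∧ a ∈ τ) → (¬ ∃ τ ∈ S, v ∈ τ ∧ b ∈ τ) →
      ∃ a b, Tri T v a b ∧ a ≠ v ∧ (∃ τ ∈ S, v ∈ τ ∧ a ∈ τ) ∧ ¬ ∃ τ ∈ S, v ∈ τ ∧ b ∈ τ :=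
    fun hab ha hb => ⟨_, _, hab, (hab.ne hT).1.symm, ha, hb⟩
  by_cases hx : ∃ τ ∈ S, v ∈ τ ∧ x ∈ τ
  · exact of_star hxy hx (not_star hxy hσS hx)
  by_cases hy : ∃ τ ∈ S, v ∈ τ ∧ y ∈ τ
  · exact of_star hxy.swap' hy hx
  have ne : ∀ {s t}, (¬ ∃ τ ∈ S, v ∈ τ ∧ s ∈ τ) → (∃ τ ∈ S, v ∈ τ ∧ t ∈ τ) → s ≠ t := by
    rintro s t hs ht rfl
    exact hs ht
  rcases hL v x y c d hxy (hS.ssubset.1 hcd) (ne hx hc) (ne hx hd) (ne hy hc) (ne hy hd) with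
    h | h | h | h
  exacts [of_star h.swap' hc hx, of_star h.swap' hd hx, of_star h.swap' hc hy,
    of_star h.swap' hd hy]

namespace Critical

theorem subset_of_not_shelled (h : Critical T) {W : Finset E}
    (hW : ¬ Shelled {σ ∈ T | σ ⊆ W}) : ∀ σ ∈ T, σ ⊆ W := by
  intro σ hσ
  by_contra hσW
  exact hW (h.shelled_restrict W ⟨σ, hσ, hσW⟩)

theorem shelled_delete (h : Critical T) (hv : ∃ σ ∈ T, v ∈ σ) : Shelled {σ ∈ T | v ∉ σ} := by
  obtain ⟨σ, hσ, hvσ⟩ := hv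
  convert h.shelled_restrict ((T.biUnion id).erase v)
    ⟨σ, hσ, fun hsub => notMem_erase v _ (hsub hvσ)⟩ using 1
  refine filter_congr fun τ hτ => ?_
  rw [subset_erase, and_iff_right (show τ ⊆ _ from subset_biUnion_of_mem id hτ)]

theorem exists_isStuck (h : Critical T) (hv : ∃ σ ∈ T, v ∈ σ) : ∃ S, IsStuck T v S := by
  by_contra! hcon
  refine h.not_shelled ((h.shelled_delete hv).of_forall_exists_attaches (filter_subset _ _) ?_)
  intro S hS hST
  by_contra! hstuck
  exact hcon S ⟨fun σ hσ hvσ => hS (mem_filter.2 ⟨hσ, hvσ⟩), hST, hstuck⟩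

theorem subset_of_sep (h : Critical T) (hab : Tri T v a b) (hs : Sep T v a b) (hσ : σ ∈ T)
    (hvσ : v ∉ σ) (haσ : a ∈ σ) (hτ : τ ∈ T) (hvτ : v ∉ τ) (hbτ : b ∈ τ) :
    ∀ ρ ∈ T, ρ ⊆ insert v (σ ∪ τ) := by
  apply h.subset_of_not_shelled
  have mem_filter_of_subset : ∀ {ρ}, ρ ∈ T → ρ ⊆ insert v (σ ∪ τ) →
    ρ ∈ ({ρ ∈ T | ρ ⊆ insert v (σ ∪ τ)} : Finset (Finset E)) := fun h h' => mem_filter.2 ⟨h, h'⟩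
  refine not_shelled_of_sep (fun ρ hρ => h.sized (mem_filter.1 (mem_coe.1 hρ)).1) ?_
    (mem_filter_of_subset hab (by grind)) (hs.mono (filter_subset _ _))
    ⟨σ, mem_filter_of_subset hσ (by grind), hvσ, haσ⟩
    ⟨τ, mem_filter_of_subset hτ (by grind), hvτ, hbτ⟩
  have hdel := h.shelled_restrict ((insert v (σ ∪ τ)).erase v)
    ⟨_, hab, fun hsub => notMem_erase v _ (hsub (mem_insert_self v _))⟩
  simpa only [filter_filter, subset_erase] using hdel

theorem subset_of_link (h : Critical T) (hab : Tri T u a b) (hcd : Tri T u c d) (hac : a ≠ c)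
    (hbc : b ≠ c) (hn : ¬ (Tri T u a c ∨ Tri T u a d ∨ Tri T u b c ∨ Tri T u b d)) :
    ∀ σ ∈ T, σ ⊆ {u, a, b, c, d} := by
  obtain ⟨hua, -, -⟩ := hab.ne h.sized
  obtain ⟨huc, -, -⟩ := hcd.ne h.sized
  apply h.subset_of_not_shelled
  intro hS
  have same_side : ∀ x y, Tri T u x y → {u, x, y} ⊆ ({u, a, b, c, d} : Finset E) →
      ((x = a ∨ x = b) ↔ (y = a ∨ y = b)) := by
    intro x y hxy hsub
    obtain ⟨hux, huy, -⟩ := hxy.ne h.sized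
    have hx := hsub (by simp : x ∈ _)
    have hy := hsub (by simp : y ∈ _)
    have hyx := hxy.swap'
    simp only [mem_insert, mem_singleton, hux.symm, huy.symm, false_or] at hx hy
    grind
  have key := hS.link_connected (f := fun x => x = a ∨ x = b) (ρ := {u})
    (fun σ hσ _ => (h.sized (mem_filter.1 hσ).1).ge) (fun σ hσ hu x hx y hy => ?_)
    _ (mem_filter.2 ⟨hab, by grind⟩) (by simp) _ (mem_filter.2 ⟨hcd, by grind⟩) (by simp)
    a (by simp [hua.symm]) c (by simp [huc.symm])
  · simp [hac.symm, hbc.symm] at key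
  · obtain ⟨hσ, hσW⟩ := mem_filter.1 hσ
    rw [mem_sdiff, mem_singleton] at hx hy
    obtain rfl | hxy := eq_or_ne x y
    · rfl
    exact propext (same_side x y (tri_of_mem h.sized hσ (singleton_subset_iff.1 hu) hx.1 hy.1
      (Ne.symm hx.2) (Ne.symm hy.2) hxy) fun t ht => hσW (by grind))

theorem twoDisjoint_of_forall_not_covered (h : Critical T) (hL : LinksTwoK2Free T)
    (hσ : σ ∈ T) (hvσ : v ∈ σ) (hτ : τ ∈ T) (hvτ : v ∉ τ)
    (hcov : ∀ x y, Tri T v x y → ¬ Covered T v x y) : TwoDisjoint T := by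
  have hdisj := fun {σ τ} => disjoint_of_forall_not_covered h.sized hL hcov (σ := σ) (τ := τ)
  have eq_or_eq : ∀ ρ ∈ T, ρ ⊆ σ ∪ τ → ρ = σ ∨ ρ = τ := by
    intro ρ hρ hsub
    by_cases hvρ : v ∈ ρ
    · exact .inl (eq_of_subset_of_card_le ((hdisj hρ hvρ hτ hvτ).left_le_of_le_sup_right hsub)
        (by rw [h.sized hρ, h.sized hσ]))
    · exact .inr (eq_of_subset_of_card_le
        ((hdisj hσ hvσ hρ hvρ).symm.left_le_of_le_sup_left hsub)
        (by rw [h.sized hρ, h.sized hτ]))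
  have heq : ({ρ ∈ T | ρ ⊆ σ ∪ τ} : Finset (Finset E)) = {σ, τ} := by
    ext ρ
    simp only [mem_filter, mem_insert, mem_singleton]
    refine ⟨fun hρ => eq_or_eq ρ hρ.1 hρ.2, ?_⟩
    rintro (rfl | rfl)
    exacts [⟨hσ, subset_union_left⟩, ⟨hτ, subset_union_right⟩]
  have hall : ∀ ρ ∈ T, ρ ⊆ σ ∪ τ := h.subset_of_not_shelled <| heq ▸
    not_shelled_pair_of_disjoint (by rw [h.sized hσ]; norm_num) (by rw [h.sized hτ]; norm_num)
      (hdisj hσ hvσ hτ hvτ)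
  exact ⟨σ, τ, hdisj hσ hvσ hτ hvτ, (filter_true_of_mem hall).symm.trans heq⟩

theorem exists_mem_star (h : Critical T) (hL : LinksTwoK2Free T) (hD : ¬ TwoDisjoint T)
    (hv : ∃ σ ∈ T, v ∈ σ) (hS : IsStuck T v S) : ∃ τ ∈ S, v ∈ τ := by
  by_contra! hvS
  obtain ⟨σ, hσ, hvσ⟩ := hv
  obtain rfl | ⟨τ, hτ⟩ := S.eq_empty_or_nonempty
  · exact hS.not_attaches σ hσ (attaches_empty σ)
  refine hD (h.twoDisjoint_of_forall_not_covered hL hσ hvσ (hS.ssubset.1 hτ) (hvS τ hτ) ?_)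
  rintro x y hxy ⟨z, hz, hxyz⟩
  obtain ⟨hvx, hvy, -⟩ := hxy.ne h.sized
  have hxyzS := hS.mem_of_notMem _ hxyz (by simp [hvx, hvy, hz.symm])
  have hnew : {x, y, v} ∉ S := fun h => hvS _ h (by simp)
  exact hS.not_attaches _ hxy.rot (attaches_triple (hS.sized h.sized) (h.sized hxy.rot) hnew
    ⟨_, hxyzS, by simp⟩ (.inl hvS))

theorem exists_sep_and_sep (h : Critical T) (hL : LinksTwoK2Free T) (hD : ¬ TwoDisjoint T)
    (hv : ∃ σ ∈ T, v ∈ σ) : ∃ a b c, Tri T v a b ∧ Tri T v a c ∧ Sep T v a b ∧ Sep T v c b ∧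
      ∃ τ ∈ T, v ∉ τ ∧ b ∈ τ := by
  obtain ⟨S, hS⟩ := h.exists_isStuck hv
  obtain ⟨a, b, hab, hav, ha, hb⟩ := hS.exists_tri h.sized hL (h.exists_mem_star hL hD hv hS)
  have hnew : ¬ Tri S v a b := fun h => hb ⟨_, h, by simp⟩
  obtain ⟨⟨τ, hτ, hbτ⟩, hvb, -⟩ := hS.of_tri h.sized hab hnew ha
  obtain ⟨ρ, hρ, hvρ, haρ⟩ := ha
  obtain ⟨c, hac, rfl⟩ := exists_tri_of_mem_of_mem (hS.sized h.sized) hρ hvρ haρ hav.symm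
  exact ⟨a, b, c, hab, hS.ssubset.1 hac, hS.sep h.sized ⟨_, hac, by simp⟩ hb,
    hS.sep h.sized ⟨_, hac, by simp⟩ hb, τ, hS.ssubset.1 hτ, fun hvτ => hvb τ hτ hvτ hbτ, hbτ⟩

theorem exists_sep (h : Critical T) (hL : LinksTwoK2Free T) (hD : ¬ TwoDisjoint T)
    (hv : ∃ σ ∈ T, v ∈ σ) : ∃ a b, Tri T v a b ∧ Sep T v a b ∧ (∃ σ ∈ T, v ∉ σ ∧ a ∈ σ) ∧
      ∃ τ ∈ T, v ∉ τ ∧ b ∈ τ := by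
  obtain ⟨a, b, -, hab, -, hs, -, hb⟩ := h.exists_sep_and_sep hL hD hv
  refine ⟨a, b, hab, hs, ?_, hb⟩
  -- Otherwise `v` is in all triangles at `a`, and a separated edge of the link of `a` contains `v`.
  by_contra! ha
  have eq_or_eq : ∀ {p q}, Tri T a p q → p = v ∨ q = v := by
    intro p q hpq
    have hmem := not_imp_not.1 (ha _ hpq) (by simp)
    have hav := (hab.ne h.sized).1
    simp only [mem_insert, mem_singleton, hav, false_or] at hmem
    exact hmem.imp Eq.symm Eq.symm
  obtain ⟨a', b', c', hab', hac', hs', hs'', τ, hτ, haτ, hbτ⟩ :=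
    h.exists_sep_and_sep hL hD (v := a) ⟨_, hab, by simp⟩
  obtain rfl : a' = v := by
    by_contra hne
    exact hs''.ne (((eq_or_eq hac').resolve_left hne).trans
      ((eq_or_eq hab').resolve_left hne).symm)
  obtain ⟨q, r, hqr, rfl⟩ := exists_tri_of_mem h.sized hτ hbτ
  simp only [mem_insert, mem_singleton, not_or] at haτ
  obtain h' | h' := tri_or_of_sep hL hab'.swap' hs'.symm hqr haτ.2.1 haτ.2.2
  · obtain rfl := (eq_or_eq h').resolve_left hs'.ne.symm
    exact haτ.2.2 (hs'.symm.eq_of_tri hab'.swap' hqr).symm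
  · obtain rfl := (eq_or_eq h').resolve_left hs'.ne.symm
    exact haτ.2.1 (hs'.symm.eq_of_tri hab'.swap' hqr.swap').symm

theorem exists_adjacent_of_unique (h : Critical T) (hv : ∃ σ ∈ T, v ∈ σ) (haxy : Tri T a x y)
    (hvaxy : v ∉ ({a, x, y} : Finset E)) (huniq : ∀ σ ∈ T, v ∉ σ → a ∈ σ → σ = {a, x, y})
    (hτ : τ ∈ T) (hvτ : v ∉ τ) (haτ : a ∉ τ) : ∃ u, u ≠ a ∧ u ≠ v ∧ Tri T x y u := by
  obtain ⟨ρ, hρ, hne, hcard⟩ := (h.shelled_delete hv).exists_adjacent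
    (mem_filter.2 ⟨haxy, hvaxy⟩) (mem_filter.2 ⟨hτ, hvτ⟩) (ne_of_mem_of_not_mem' (by simp) haτ)
  obtain ⟨hρ, hvρ⟩ := mem_filter.1 hρ
  have haρ : a ∉ ρ := fun haρ => hne (huniq ρ hρ hvρ haρ)
  have hxyρ : {x, y} ⊆ ρ := by
    rw [h.sized haxy, h.sized hρ, or_self, insert_inter_of_notMem haρ] at hcard
    refine inter_eq_left.1 (eq_of_subset_of_card_le inter_subset_left ?_)
    exact card_le_two.trans (by omega)
  obtain ⟨hx, hy⟩ := insert_subset_iff.1 hxyρ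
  rw [singleton_subset_iff] at hy
  obtain ⟨u, hu, rfl⟩ := exists_tri_of_mem_of_mem h.sized hρ hx hy (haxy.ne h.sized).2.2
  simp only [mem_insert, mem_singleton, not_or] at haρ hvρ
  exact ⟨u, Ne.symm haρ.2.2, Ne.symm hvρ.2.2, hu⟩

end Critical

end Critical

section Band

variable {E : Type*} [DecidableEq E] {T : Finset (Finset E)} {a b p q r u v w x y z : E}
  {σ τ : Finset E}

namespace Critical

theorem exists_tri_tri_of_sep (hT : (T : Set (Finset E)).Sized 3) (hL : LinksTwoK2Free T)
    (hab : Tri T v a b) (hs : Sep T v a b) (hσ : σ ∈ T) (hvσ : v ∉ σ) (haσ : a ∈ σ) :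
    ∃ x y, v ≠ y ∧ Tri T v a x ∧ Tri T a x y := by
  obtain ⟨x, y, haxy, rfl⟩ := exists_tri_of_mem hT hσ haσ
  simp only [mem_insert, mem_singleton, not_or] at hvσ
  obtain hx | hy := tri_or_of_sep hL hab hs haxy hvσ.2.1 hvσ.2.2
  exacts [⟨x, y, hvσ.2.2, hx, haxy⟩, ⟨y, x, hvσ.2.1, hy, haxy.swap'⟩]

/-- If `axy` is the only triangle at `a` avoiding `v`, then `xy` lies in another triangle, so that
a separated edge of the link of `a` contains `v`, and its other end is `x` or `y`. -/
theorem sep_of_unique (h : Critical T) (hL : LinksTwoK2Free T) (hD : ¬ TwoDisjoint T)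
    (hv : ∃ σ ∈ T, v ∈ σ) (haxy : Tri T a x y) (hvaxy : v ∉ ({a, x, y} : Finset E))
    (huniq : ∀ σ ∈ T, v ∉ σ → a ∈ σ → σ = {a, x, y}) (hτ : τ ∈ T) (hvτ : v ∉ τ) (haτ : a ∉ τ) :
    Sep T a v x := by
  obtain ⟨u, hua, -, hxyu⟩ := h.exists_adjacent_of_unique hv haxy hvaxy huniq hτ hvτ haτ
  have hxy : Covered T a x y := ⟨u, hua, hxyu⟩
  have mem_of_tri : ∀ {s t}, Tri T a s t → v ≠ s → v ≠ t → s = x ∨ s = y := by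
    intro s t hst hvs hvt
    have heq := huniq _ hst (by simp_all) (by simp)
    have hs : s ∈ ({a, x, y} : Finset E) := heq ▸ by simp
    simpa [(hst.ne h.sized).1.symm] using hs
  have of_sep : ∀ {q}, Tri T a v q → Sep T a v q → (∃ τ ∈ T, a ∉ τ ∧ q ∈ τ) → Sep T a v x := by
    rintro q hvq hs ⟨ρ, hρ, haρ, hqρ⟩
    have hvρ : v ∉ ρ := fun hvρ =>
      hs.not_covered hvq (covered_of_mem h.sized hρ haρ hvρ hqρ hs.ne)
    obtain ⟨s, t, hqst, rfl⟩ := exists_tri_of_mem h.sized hρ hqρ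
    simp only [mem_insert, mem_singleton, not_or] at haρ hvρ
    have hq : q = x ∨ q = y := (tri_or_of_sep hL hvq.swap' hs.symm hqst haρ.2.1 haρ.2.2).elim
      (mem_of_tri · hvρ.1 hvρ.2.1) (mem_of_tri · hvρ.1 hvρ.2.2)
    obtain rfl | rfl := hq
    exacts [hs, hs.trans_right haxy.swap' hxy.symm]
  obtain ⟨p, q, hpq, hs, hp, hq⟩ := h.exists_sep hL hD ⟨_, haxy, mem_insert_self a _⟩
  obtain rfl | hvp := eq_or_ne v p
  · exact of_sep hpq hs hq
  obtain rfl | hvq := eq_or_ne v q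
  · exact of_sep hpq.swap' hs.symm hp
  obtain rfl | rfl := mem_of_tri hpq hvp hvq <;>
    obtain rfl | rfl := mem_of_tri hpq.swap' hvq hvp
  exacts [absurd rfl hs.ne, absurd hxy (hs.not_covered hpq),
    absurd hxy.symm (hs.not_covered hpq), absurd rfl hs.ne]

theorem not_sep_of_tri (h : Critical T) (hL : LinksTwoK2Free T) (hD : ¬ TwoDisjoint T)
    (hab : Tri T v a b) (hpq : Tri T a p q) (hqr : Tri T b q r) (hpr : Tri T b p r)
    (hvp : v ≠ p) (hvq : v ≠ q) (hvr : v ≠ r) : ¬ Sep T v a b := by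
  intro hs
  wlog hp : Tri T v a p generalizing p q
  · exact this hpq.swap' hpr hqr hvq hvp
      ((tri_or_of_sep hL hab hs hpq hvp hvq).resolve_left hp)
  obtain ⟨hva, hvb, hab'⟩ := hab.ne h.sized
  obtain ⟨hap, haq, hpq'⟩ := hpq.ne h.sized
  obtain ⟨hbq, hbr, hqr'⟩ := hqr.ne h.sized
  obtain ⟨hbp, -, hpr'⟩ := hpr.ne h.sized
  have har : a ≠ r := by
    rintro rfl
    exact hvp (hs.eq_of_tri hab hpr.rot').symm
  have hsp : Sep T v b p := hs.symm.trans_right hp ⟨q, hvq.symm, hpq⟩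
  have hr : Tri T v b r := (tri_or_of_sep hL hab.swap' hs.symm hpr hvp hvr).resolve_left
    fun hbp => hvr (hsp.eq_of_tri hbp hpr).symm
  have huniq : ∀ σ ∈ T, v ∉ σ → a ∈ σ → σ = {a, p, q} := by
    intro σ hσ hvσ haσ
    have hpσ : p ∈ σ := by
      have hp' := h.subset_of_sep hab hs hσ hvσ haσ hqr (by simp [*]) (by simp) _ hpq
        (by simp : p ∈ _)
      simpa [hvp.symm, hbp.symm, hpq', hpr'] using hp'
    have hqσ : q ∈ σ := by
      have hq' := h.subset_of_sep hab hs hσ hvσ haσ hpr (by simp [*]) (by simp) _ hpq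
        (by simp : q ∈ _)
      simpa [hvq.symm, hbq.symm, hpq'.symm, hqr'] using hq'
    refine (eq_of_subset_of_card_le ?_ (by rw [h.sized hσ, h.sized hpq])).symm
    grind
  have hsa := h.sep_of_unique hL hD ⟨_, hab, by simp⟩ hpq (by simp [*]) huniq hqr (by simp [*])
    (by simp [*])
  have hq := h.subset_of_sep hp.swap hsa hr (by simp [hva.symm, *]) (by simp) hpr (by simp [*])
    (by simp) _ hpq (by simp : q ∈ _)
  simp only [mem_insert, mem_union, mem_singleton] at hq
  grind only

/-- Two triangles at `a` avoiding `v`, and one at `b`, would have to cover the same vertices. -/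
theorem eq_of_sep (h : Critical T) (hL : LinksTwoK2Free T) (hD : ¬ TwoDisjoint T)
    (hab : Tri T v a b) (hs : Sep T v a b) (hb : ∃ τ ∈ T, v ∉ τ ∧ b ∈ τ) (hσ : σ ∈ T)
    (hvσ : v ∉ σ) (haσ : a ∈ σ) (hτ : τ ∈ T) (hvτ : v ∉ τ) (haτ : a ∈ τ) : σ = τ := by
  obtain ⟨ρ, hρ, hvρ, hbρ⟩ := hb
  have hσsub := h.subset_of_sep hab hs hτ hvτ haτ hρ hvρ hbρ σ hσ
  have hτsub := h.subset_of_sep hab hs hσ hvσ haσ hρ hvρ hbρ τ hτ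
  have hbσ : b ∉ σ := fun hbσ => hs.not_covered hab (covered_of_mem h.sized hσ hvσ haσ hbσ hs.ne)
  have hbτ : b ∉ τ := fun hbτ => hs.not_covered hab (covered_of_mem h.sized hτ hvτ haτ hbτ hs.ne)
  obtain ⟨z, w, hzw, rfl⟩ := exists_tri_of_mem h.sized hρ hbρ
  simp only [mem_insert, mem_singleton, not_or] at hvρ
  have mem_of_mem : ∀ {s}, s ∈ σ → s ∉ τ → s = z ∨ s = w := by
    intro s hsσ hsτ
    simpa [ne_of_mem_of_not_mem hsσ hvσ, ne_of_mem_of_not_mem hsσ hbσ, hsτ] using hσsub hsσ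
  have mem_of_mem' : ∀ {s}, s ∈ τ → s ∉ σ → s = z ∨ s = w := by
    intro s hsτ hsσ
    simpa [ne_of_mem_of_not_mem hsτ hvτ, ne_of_mem_of_not_mem hsτ hbτ, hsσ] using hτsub hsτ
  by_contra hne
  have hcard : #σ = #τ := (h.sized hσ).trans (h.sized hτ).symm
  obtain ⟨s, hsσ, hsτ⟩ := not_subset.1 fun hsub => hne (eq_of_subset_of_card_le hsub hcard.ge)
  obtain ⟨t, htτ, htσ⟩ := not_subset.1 fun hsub => hne (eq_of_subset_of_card_le hsub hcard.le).symm
  have hst : s ≠ t := ne_of_mem_of_not_mem hsσ htσ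
  have has : a ≠ s := ne_of_mem_of_not_mem haτ hsτ
  have hat : a ≠ t := ne_of_mem_of_not_mem haσ htσ
  obtain ⟨r, hasr, rfl⟩ := exists_tri_of_mem_of_mem h.sized hσ haσ hsσ has
  obtain ⟨-, har, hsr⟩ := hasr.ne h.sized
  have hrσ : r ∈ ({a, s, r} : Finset E) := by simp
  have hrt : t ≠ r := (ne_of_mem_of_not_mem hrσ htσ).symm
  have hrτ : r ∈ τ := by
    by_contra hrτ
    have := mem_of_mem hsσ hsτ
    have := mem_of_mem hrσ hrτ
    have := mem_of_mem' htτ htσ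
    grind only
  have hatr := tri_of_mem h.sized hτ haτ htτ hrτ hat har hrt
  have hfalse : ∀ {s t}, Tri T b s t → v ≠ s → v ≠ t → Tri T a s r → Tri T a t r → False :=
    fun hbst hvs hvt hs' ht' => h.not_sep_of_tri hL hD hab.swap' hbst ht' hs' hvs hvt
      (ne_of_mem_of_not_mem hrτ hvτ).symm hs.symm
  obtain rfl | rfl := mem_of_mem hsσ hsτ <;> obtain rfl | rfl := mem_of_mem' htτ htσ
  exacts [hst rfl, hfalse hzw hvρ.2.1 hvρ.2.2 hasr hatr,
    hfalse hzw.swap' hvρ.2.2 hvρ.2.1 hasr hatr, hst rfl]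

end Critical

/-- Five consecutive triangles around a separated edge `ab` of the link of `v`. -/
structure IsStrip (T : Finset (Finset E)) (w z b v a x y : E) : Prop where
  sep : Sep T v a b
  tri₁ : Tri T w z b
  tri₂ : Tri T z b v
  tri₃ : Tri T b v a
  tri₄ : Tri T v a x
  tri₅ : Tri T a x y
  ne_left : v ≠ w
  ne_right : v ≠ y

namespace IsStrip

theorem symm (hS : IsStrip T w z b v a x y) : IsStrip T y x a v b z w :=
  ⟨hS.sep.symm, hS.tri₅.rev, hS.tri₄.rev, hS.tri₃.rev, hS.tri₂.rev, hS.tri₁.rev, hS.ne_right,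
    hS.ne_left⟩

theorem sep_left (hS : IsStrip T w z b v a x y) : Sep T v a z :=
  hS.sep.trans_right hS.tri₂.rev ⟨w, hS.ne_left.symm, hS.tri₁.rev⟩

theorem nodup_mid (hT : (T : Set (Finset E)).Sized 3) (hS : IsStrip T w z b v a x y) :
    [z, b, v, a, x].Nodup := by
  have hzx : z ≠ x := (hS.sep_left.symm.trans_right hS.tri₄ ⟨y, hS.ne_right.symm, hS.tri₅⟩).ne
  have haz : a ≠ z := hS.sep_left.ne
  have hbx : b ≠ x := hS.symm.sep_left.ne
  have := hS.tri₂.ne hT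
  have := hS.tri₃.ne hT
  have := hS.tri₄.ne hT
  grind

theorem nodup_left (hT : (T : Set (Finset E)).Sized 3) (hS : IsStrip T w z b v a x y) :
    [w, z, b, v, a].Nodup := by
  have haw : a ≠ w := by
    rintro rfl
    exact (hS.tri₂.ne hT).2.1 (hS.sep.eq_of_tri hS.tri₃.rot hS.tri₁.swap')
  have := hS.nodup_mid hT
  have := hS.tri₁.ne hT
  have := hS.ne_left
  grind

theorem nodup_right (hT : (T : Set (Finset E)).Sized 3) (hS : IsStrip T w z b v a x y) :
    [b, v, a, x, y].Nodup :=
  List.nodup_reverse.1 (hS.symm.nodup_left hT)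

end IsStrip

/-- Every seven consecutive terms of `s` form a strip. -/
def IsStripSeq (T : Finset (Finset E)) (s : ℕ → E) : Prop :=
  ∀ k, IsStrip T (s k) (s (k + 1)) (s (k + 2)) (s (k + 3)) (s (k + 4)) (s (k + 5)) (s (k + 6))

namespace IsStripSeq

variable {s : ℕ → E}

theorem shift (hs : IsStripSeq T s) (k : ℕ) : IsStripSeq T fun j => s (k + j) :=
  fun j => hs (k + j)

theorem ne (hT : (T : Set (Finset E)).Sized 3) (hs : IsStripSeq T s) (k : ℕ) :
    s k ≠ s (k + 1) ∧ s k ≠ s (k + 2) ∧ s k ≠ s (k + 3) ∧ s k ≠ s (k + 4) := by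
  have := (hs k).nodup_left hT
  grind

end IsStripSeq

namespace Critical

theorem exists_isStrip (h : Critical T) (hL : LinksTwoK2Free T) (hD : ¬ TwoDisjoint T)
    (hv : ∃ σ ∈ T, v ∈ σ) : ∃ w z b a x y, IsStrip T w z b v a x y := by
  obtain ⟨a, b, hab, hs, ⟨σ, hσ, hvσ, haσ⟩, τ, hτ, hvτ, hbτ⟩ := h.exists_sep hL hD hv
  obtain ⟨x, y, hvy, hax, haxy⟩ := exists_tri_tri_of_sep h.sized hL hab hs hσ hvσ haσ
  obtain ⟨z, w, hvw, hbz, hbzw⟩ := exists_tri_tri_of_sep h.sized hL hab.swap' hs.symm hτ hvτ hbτ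
  exact ⟨w, z, b, a, x, y, hs, hbzw.rev, hbz.rev, hab.swap'.swap, hax, haxy, hvw, hvy⟩

theorem subset_of_isStrip (h : Critical T) (hS : IsStrip T w z b v a x y) :
    ∀ ρ ∈ T, ρ ⊆ {w, z, b, v, a, x, y} := by
  intro ρ hρ
  have hl := hS.nodup_left h.sized
  have hr := hS.nodup_right h.sized
  refine (h.subset_of_sep hS.tri₃.rot hS.sep hS.tri₅ ?_ ?_ hS.tri₁ ?_ ?_ ρ hρ).trans ?_ <;> grind

theorem eq_of_isStrip (h : Critical T) (hL : LinksTwoK2Free T) (hD : ¬ TwoDisjoint T)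
    (hS : IsStrip T w z b v a x y) (hσ : σ ∈ T) (hvσ : v ∉ σ) (haσ : a ∈ σ) : σ = {a, x, y} := by
  have hl := hS.nodup_left h.sized
  have hr := hS.nodup_right h.sized
  exact h.eq_of_sep hL hD hS.tri₃.rot hS.sep ⟨_, hS.tri₁, by grind, by simp⟩ hσ hvσ haσ hS.tri₅
    (by grind) (by simp)

theorem exists_next (h : Critical T) (hL : LinksTwoK2Free T) (hD : ¬ TwoDisjoint T)
    (hS : IsStrip T w z b v a x y) : ∃ u, IsStrip T z b v a x y u := by
  have hl := hS.nodup_left h.sized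
  have hr := hS.nodup_right h.sized
  have hv : ∃ σ ∈ T, v ∈ σ := ⟨_, hS.tri₃, by simp⟩
  have hvaxy : v ∉ ({a, x, y} : Finset E) := by grind
  have huniq := fun σ => h.eq_of_isStrip hL hD hS (σ := σ)
  have hvw : v ∉ ({w, z, b} : Finset E) := by grind
  have haw : a ∉ ({w, z, b} : Finset E) := by grind
  have hs := h.sep_of_unique hL hD hv hS.tri₅ hvaxy huniq hS.tri₁ hvw haw
  obtain ⟨u, hua, -, hxyu⟩ := h.exists_adjacent_of_unique hv hS.tri₅ hvaxy huniq hS.tri₁ hvw haw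
  exact ⟨u, hs.symm, hS.tri₂, hS.tri₃, hS.tri₄, hS.tri₅, hxyu, hS.sep_left.ne, hua.symm⟩

theorem eq_of_isStrip_of_isStrip (h : Critical T) (hS : IsStrip T w z b v a x y)
    (hS' : IsStrip T z b v a x y u) (hwx : w = x) : z = y := by
  subst hwx
  have hl := hS.nodup_left h.sized
  have hr := hS.nodup_right h.sized
  have hy := h.subset_of_sep hS'.tri₃.rot hS'.sep hS.tri₁ (by grind) (by grind) hS.tri₂ (by grind)
    (by grind) _ hS.tri₅ (by simp : y ∈ _)
  grind

theorem exists_seq (h : Critical T) (hL : LinksTwoK2Free T) (hD : ¬ TwoDisjoint T) :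
    ∃ s, IsStripSeq T s := by
  obtain ⟨σ, hσ⟩ := h.nonempty
  obtain ⟨v, hv⟩ := card_pos.1 (by rw [h.sized hσ]; norm_num : 0 < #σ)
  obtain ⟨w, z, b, a, x, y, hS⟩ := h.exists_isStrip hL hD ⟨σ, hσ, hv⟩
  have : Nonempty E := ⟨v⟩
  choose! next hnext using fun t : Fin 7 → E =>
    h.exists_next hL hD (w := t 0) (z := t 1) (b := t 2) (v := t 3) (a := t 4) (x := t 5) (y := t 6)
  let step (t : Fin 7 → E) : Fin 7 → E := ![t 1, t 2, t 3, t 4, t 5, t 6, next t]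
  have hstrip : ∀ k, let t := step^[k] ![w, z, b, v, a, x, y]
      IsStrip T (t 0) (t 1) (t 2) (t 3) (t 4) (t 5) (t 6) := by
    intro k
    induction k with
    | zero => exact hS
    | succ k ih => rw [Function.iterate_succ_apply']; exact hnext _ ih
  refine ⟨fun k => step^[k] ![w, z, b, v, a, x, y] 0, fun k => ?_⟩
  convert hstrip k using 1 <;> simp only [Function.iterate_succ_apply'] <;> rfl

end Critical

/-- `T` consists of the triangles `{i, i + 1, i + 2}` with `i ∈ ℤ/n`, where the elements of `ℤ/n`
are represented as an `n`-periodic sequence. -/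
def IsBand (T : Finset (Finset E)) (n : ℕ) : Prop :=
  ∃ s : ℕ → E, s.Periodic n ∧ Set.InjOn s (Set.Iio n) ∧
    T = (range n).image fun i => {s i, s (i + 1), s (i + 2)}

namespace Critical

theorem eq_triple_of_seq (h : Critical T) (hL : LinksTwoK2Free T) (hD : ¬ TwoDisjoint T)
    {s : ℕ → E} (hs : IsStripSeq T s) (hσ : σ ∈ T) :
    ∃ i, σ = {s i, s (i + 1), s (i + 2)} := by
  suffices ∃ i ≥ 3, s i ∉ σ ∧ s (i + 1) ∈ σ by
    obtain ⟨i, hi, hiσ, hi'σ⟩ := this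
    obtain ⟨k, rfl⟩ := Nat.exists_eq_add_of_le' hi
    exact ⟨_, h.eq_of_isStrip hL hD (hs k) hσ hiσ hi'σ⟩
  by_contra! hstay
  obtain ⟨i, hi, hiσ⟩ : ∃ i ≥ 3, s i ∉ σ := by
    by_contra! hall
    have hsub : {s 3, s 4, s 5, s 6} ⊆ σ := by
      simp [insert_subset_iff, hall]
    have hcard : #{s 3, s 4, s 5, s 6} = 4 := by
      have := (hs 2).nodup_mid h.sized
      grind
    have := card_le_card hsub
    rw [hcard, h.sized hσ] at this
    omega
  have hnot : ∀ j, s (i + j) ∉ σ := by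
    intro j
    induction j with
    | zero => exact hiσ
    | succ j ih => exact hstay (i + j) (by omega) ih
  obtain ⟨x, hx⟩ := card_pos.1 (by rw [h.sized hσ]; norm_num : 0 < #σ)
  have hxi := h.subset_of_isStrip (hs i) σ hσ hx
  simp only [mem_insert, mem_singleton] at hxi
  have := hnot 0
  grind

theorem isBand_of_seq (h : Critical T) (hL : LinksTwoK2Free T) (hD : ¬ TwoDisjoint T)
    {s : ℕ → E} (hs : IsStripSeq T s) {n : ℕ} (hn : 0 < n) (hper : s.Periodic n)
    (hinj : ∀ k d, 0 < d → d < n → s k ≠ s (k + d)) : IsBand T n := by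
  refine ⟨s, hper, ?_, ?_⟩
  · intro i hi j hj hij
    by_contra hne
    wlog hlt : i < j generalizing i j
    · exact this hj hi hij.symm (Ne.symm hne) (by omega)
    exact hinj i (j - i) (by omega) (by grind) (by rwa [Nat.add_sub_cancel' hlt.le])
  · ext σ
    simp only [mem_image, mem_range]
    constructor
    · intro hσ
      obtain ⟨i, rfl⟩ := h.eq_triple_of_seq hL hD hs hσ
      refine ⟨i % n, Nat.mod_lt _ hn, ?_⟩
      have hmod : ∀ j, s (i % n + j) = s (i + j) := fun j => by
        rw [← hper.map_mod_nat, Nat.mod_add_mod, hper.map_mod_nat]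
      rw [hmod 1, hmod 2, ← add_zero (i % n), hmod 0, add_zero]
    · rintro ⟨i, -, rfl⟩
      exact (hs i).tri₁

theorem seq_add_seven_eq (h : Critical T) {s : ℕ → E} (hs : IsStripSeq T s) (k : ℕ) :
    s (k + 7) = s k ∨ s (k + 7) = s (k + 1) ∨ s (k + 7) = s (k + 2) := by
  have hmem := h.subset_of_isStrip (hs k) _ (hs (k + 1)).tri₅ (by simp : s (k + 7) ∈ _)
  have h3 := hs.ne h.sized (k + 3)
  have h4 := hs.ne h.sized (k + 4)
  have h5 := hs.ne h.sized (k + 5)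
  have h6 := hs.ne h.sized (k + 6)
  simp only [mem_insert, mem_singleton] at hmem
  grind only

theorem isBand_five_of_eq (h : Critical T) (hL : LinksTwoK2Free T) (hD : ¬ TwoDisjoint T)
    {s : ℕ → E} (hs : IsStripSeq T s) {k : ℕ} (hk : s k = s (k + 5)) : IsBand T 5 := by
  have hper : ∀ j, s (k + j) = s (k + j + 5) := by
    intro j
    induction j with
    | zero => exact hk
    | succ j ih => exact h.eq_of_isStrip_of_isStrip (hs (k + j)) (hs (k + j + 1)) ih
  refine h.isBand_of_seq hL hD (hs.shift k) (by norm_num) (fun j => (hper j).symm)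
    fun j d _ _ => ?_
  have := hs.ne h.sized (k + j)
  interval_cases d <;> grind only

theorem isBand_six_of_eq (h : Critical T) (hL : LinksTwoK2Free T) (hD : ¬ TwoDisjoint T)
    {s : ℕ → E} (hs : IsStripSeq T s) (h5 : ∀ k, s k ≠ s (k + 5)) {k : ℕ}
    (hk : s k = s (k + 6)) : IsBand T 6 := by
  have hper : ∀ j, s (k + j) = s (k + j + 6) := by
    intro j
    induction j with
    | zero => exact hk
    | succ j ih =>
      have := (hs.ne h.sized (k + j + 6)).1
      have := h.seq_add_seven_eq hs (k + j)
      have := h5 (k + j + 2)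
      grind only
  refine h.isBand_of_seq hL hD (hs.shift k) (by norm_num) (fun j => (hper j).symm)
    fun j d _ _ => ?_
  have := hs.ne h.sized (k + j)
  have := h5 (k + j)
  interval_cases d <;> grind only

theorem isBand_seven_of_ne (h : Critical T) (hL : LinksTwoK2Free T) (hD : ¬ TwoDisjoint T)
    {s : ℕ → E} (hs : IsStripSeq T s) (h5 : ∀ k, s k ≠ s (k + 5)) (h6 : ∀ k, s k ≠ s (k + 6)) :
    IsBand T 7 := by
  refine h.isBand_of_seq hL hD hs (by norm_num) (fun k => ?_) fun k d _ _ => ?_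
  · have := h.seq_add_seven_eq hs k
    have := h5 (k + 2)
    have := h6 (k + 1)
    grind only
  · have := hs.ne h.sized k
    have := h5 k
    have := h6 k
    interval_cases d <;> grind only

theorem exists_isBand (h : Critical T) (hL : LinksTwoK2Free T) (hD : ¬ TwoDisjoint T) :
    IsBand T 5 ∨ IsBand T 6 ∨ IsBand T 7 := by
  obtain ⟨s, hs⟩ := h.exists_seq hL hD
  by_cases! h5 : ∃ k, s k = s (k + 5)
  · obtain ⟨k, hk⟩ := h5
    exact .inl (h.isBand_five_of_eq hL hD hs hk)
  by_cases! h6 : ∃ k, s k = s (k + 6)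
  · obtain ⟨k, hk⟩ := h6
    exact .inr (.inl (h.isBand_six_of_eq hL hD hs h5 hk))
  · exact .inr (.inr (h.isBand_seven_of_ne hL hD hs h5 h6))

end Critical

end Band

section Map

variable {E F : Type*} [DecidableEq E] {Γ Γ₀ : FinComplex E} {Δ : FinComplex F} {f : F → E}

/-- The image of a complex under a map of the ground sets. Up to this construction with `f`
injective on the vertices, isomorphic complexes are equal. -/
def map (Δ : FinComplex F) (f : F → E) : FinComplex E where
  faces := Δ.faces.image (Finset.image f)
  empty_mem := mem_image.2 ⟨∅, Δ.empty_mem, image_empty f⟩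
  down_closed := by
    intro s hs t hts
    obtain ⟨u, hu, rfl⟩ := mem_image.1 hs
    obtain ⟨v, hvu, rfl⟩ := subset_image_iff.1 hts
    exact mem_image_of_mem _ (Δ.down_closed u hu v hvu)

theorem coe_subset_vertexSet {s : Finset F} (hs : s ∈ Δ.faces) : (s : Set F) ⊆ Δ.vertexSet :=
  fun _ hx => mem_vertexSet_of_mem hs hx

theorem mem_map {s : Finset E} : s ∈ (Δ.map f).faces ↔ ∃ u ∈ Δ.faces, u.image f = s := mem_image

theorem image_mem_map (hf : Set.InjOn f Δ.vertexSet) {s : Finset F} (hs : ↑s ⊆ Δ.vertexSet) :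
    s.image f ∈ (Δ.map f).faces ↔ s ∈ Δ.faces := by
  refine ⟨fun h => ?_, fun h => mem_map.2 ⟨s, h, rfl⟩⟩
  obtain ⟨u, hu, he⟩ := mem_map.1 h
  rw [← coe_inj, coe_image, coe_image] at he
  rwa [← coe_injective ((hf.image_eq_image_iff (coe_subset_vertexSet hu) hs).1 he)]

theorem vertexSet_map (Δ : FinComplex F) (f : F → E) :
    (Δ.map f).vertexSet = f '' Δ.vertexSet := by
  ext x
  constructor
  · intro hx
    obtain ⟨u, hu, he⟩ := mem_map.1 hx
    obtain ⟨y, hy, rfl⟩ := mem_image.1 (he ▸ mem_singleton_self x)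
    exact ⟨y, mem_vertexSet_of_mem hu hy, rfl⟩
  · rintro ⟨y, hy, rfl⟩
    exact mem_map.2 ⟨{y}, hy, image_singleton f y⟩

theorem pair_mem_map [DecidableEq F] (hf : Set.InjOn f Δ.vertexSet) {x y : F}
    (hx : x ∈ Δ.vertexSet) (hy : y ∈ Δ.vertexSet) :
    {f x, f y} ∈ (Δ.map f).faces ↔ {x, y} ∈ Δ.faces := by
  rw [← image_mem_map hf (s := {x, y})
    (by rw [coe_pair]; exact Set.insert_subset hx (Set.singleton_subset_iff.2 hy)),
    image_insert, image_singleton]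

theorem triangles_map (hf : Set.InjOn f Δ.vertexSet) :
    (Δ.map f).triangles = Δ.triangles.image (Finset.image f) := by
  have hcard : ∀ u ∈ Δ.faces, #(u.image f) = #u := fun u hu =>
    card_image_of_injOn (hf.mono (coe_subset_vertexSet hu))
  rw [triangles, map, filter_image, triangles]
  exact congrArg _ (filter_congr fun u hu => by rw [hcard u hu])

theorem isIso_map (hf : Set.InjOn f Δ.vertexSet) : (Δ.map f).IsIso Δ := by
  classical
  let e : (Δ.map f).vertexSet ≃ Δ.vertexSet :=
    (Equiv.setCongr (vertexSet_map Δ f)).trans (Equiv.Set.imageOfInjOn f _ hf).symm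
  have he (x : (Δ.map f).vertexSet) : f (e x) = x := congrArg Subtype.val
    ((Equiv.Set.imageOfInjOn f _ hf).apply_symm_apply (Equiv.setCongr (vertexSet_map Δ f) x))
  refine ⟨e, fun s => ?_⟩
  have himage : s.map (Function.Embedding.subtype _) =
      ((s.map e.toEmbedding).map (Function.Embedding.subtype _)).image f := by
    simp only [map_eq_image, image_image]
    exact image_congr fun x _ => (he x).symm
  rw [himage, image_mem_map hf]
  intro x hx
  obtain ⟨y, -, rfl⟩ := Finset.mem_map.1 (mem_coe.1 hx)
  exact y.2

theorem IsIso.exists_map (h : Γ.IsIso Δ) (hne : Δ.vertexSet.Nonempty) :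
    ∃ f : F → E, Set.InjOn f Δ.vertexSet ∧ Γ = Δ.map f := by
  classical
  obtain ⟨e, he⟩ := h
  obtain ⟨x₀, hx₀⟩ := hne
  let f : F → E := Function.extend Subtype.val (fun x => ↑(e.symm x)) fun _ => e.symm ⟨x₀, hx₀⟩
  have hf (x : Δ.vertexSet) : f x = e.symm x := Subtype.val_injective.extend_apply ..
  have himage (s : Finset Γ.vertexSet) : s.map (Function.Embedding.subtype _) =
      ((s.map e.toEmbedding).map (Function.Embedding.subtype _)).image f := by
    simp only [map_eq_image, image_image]
    exact image_congr fun x _ => by simp [hf]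
  refine ⟨f, fun x hx y hy hxy => ?_, FinComplex.ext (Finset.ext fun t => ⟨fun ht => ?_, ?_⟩)⟩
  · have hxy' : (e.symm ⟨x, hx⟩ : E) = e.symm ⟨y, hy⟩ := by rwa [← hf, ← hf]
    exact congrArg Subtype.val (e.symm.injective (Subtype.ext hxy'))
  · have hsub := subtype_map_of_mem (p := (· ∈ Γ.vertexSet)) fun x hx => mem_vertexSet_of_mem ht hx
    rw [← hsub] at ht ⊢
    exact mem_map.2 ⟨_, (he _).1 ht, (himage _).symm⟩
  · intro ht
    obtain ⟨u, hu, rfl⟩ := mem_map.1 ht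
    have hsub := subtype_map_of_mem (p := (· ∈ Δ.vertexSet)) fun x hx => mem_vertexSet_of_mem hu hx
    have hmap : ((u.subtype (· ∈ Δ.vertexSet)).map e.symm.toEmbedding).map e.toEmbedding =
        u.subtype (· ∈ Δ.vertexSet) := by
      ext x
      simp
    rw [← hsub, ← hmap, ← himage, he, hmap, hsub]
    exact hu

end Map

section AddEdges

variable {E : Type*} {Γ₀ Γ : FinComplex E}

theorem IsAddEdges.refl (Γ : FinComplex E) : IsAddEdges Γ Γ :=
  ⟨subset_rfl, fun _ h h' => absurd h h'⟩

theorem IsAddEdges.mem_iff (h : IsAddEdges Γ₀ Γ) {s : Finset E} (hs : #s ≠ 2) :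
    s ∈ Γ.faces ↔ s ∈ Γ₀.faces := by
  refine ⟨fun hsΓ => ?_, fun hs => h.1 hs⟩
  by_contra hsΓ₀
  have hdim := h.2 s hsΓ hsΓ₀
  rw [faceDim] at hdim
  omega

theorem IsAddEdges.triangles_eq (h : IsAddEdges Γ₀ Γ) : Γ.triangles = Γ₀.triangles := by
  ext s
  simp only [mem_triangles]
  exact and_congr_left fun hs => h.mem_iff (by omega)

theorem IsAddEdges.vertexSet_eq (h : IsAddEdges Γ₀ Γ) : Γ.vertexSet = Γ₀.vertexSet := by
  ext x
  exact h.mem_iff (by simp)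

theorem IsAddEdges.card_le (h : IsAddEdges Γ₀ Γ) (h₀ : ∀ s ∈ Γ₀.faces, #s ≤ 3) :
    ∀ s ∈ Γ.faces, #s ≤ 3 := by
  intro s hs
  by_cases h2 : #s = 2
  · omega
  · exact h₀ s ((h.mem_iff h2).1 hs)

end AddEdges

section GeneratedBy

variable {E : Type*} {F : Finset (Finset E)} {x y : E}

/-- `x` and `y` lie in a common member of `F`. For a concrete `F` this is decided much faster than
membership of `{x, y}` in a complex generated by `F`. -/
def Joined (F : Finset (Finset E)) (x y : E) : Prop := ∃ t ∈ F, x ∈ t ∧ y ∈ t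

variable [DecidableEq E]

instance (F : Finset (Finset E)) (x y : E) : Decidable (Joined F x y) := by
  unfold Joined
  infer_instance

theorem mem_generatedBy {s : Finset E} :
    s ∈ (generatedBy F).faces ↔ s = ∅ ∨ ∃ t ∈ F, s ⊆ t := by
  simp only [generatedBy, mem_insert, mem_biUnion, mem_powerset]

theorem mem_vertexSet_generatedBy : x ∈ (generatedBy F).vertexSet ↔ Joined F x x := by
  change {x} ∈ (generatedBy F).faces ↔ _
  rw [mem_generatedBy]
  simp [Joined]

theorem pair_mem_generatedBy : {x, y} ∈ (generatedBy F).faces ↔ Joined F x y := by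
  rw [mem_generatedBy]
  simp [Joined, insert_subset_iff]

theorem triangles_generatedBy (hF : ∀ t ∈ F, #t ≤ 3) :
    (generatedBy F).triangles = {t ∈ F | #t = 3} := by
  ext s
  rw [mem_triangles, mem_generatedBy, mem_filter]
  constructor
  · rintro ⟨rfl | ⟨t, ht, hst⟩, hs⟩
    · simp at hs
    · obtain rfl := eq_of_subset_of_card_le hst ((hF t ht).trans hs.ge)
      exact ⟨ht, hs⟩
  · rintro ⟨hsF, hs⟩
    exact ⟨Or.inr ⟨s, hsF, subset_rfl⟩, hs⟩

end GeneratedBy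

section Image

variable {E F : Type*} [DecidableEq E] [DecidableEq F] {f : F → E} {U : Set F}

theorem Shelled.image {S : Finset (Finset F)} (h : Shelled S) (hf : Set.InjOn f U)
    (hU : ∀ σ ∈ S, (σ : Set F) ⊆ U) : Shelled (S.image (Finset.image f)) := by
  induction h with
  | empty => exact Shelled.empty
  | @attach S σ _ ha ih =>
    rw [forall_mem_insert] at hU
    have hinter : ∀ τ ∈ S, σ.image f ∩ τ.image f = (σ ∩ τ).image f := fun τ hτ =>
      (image_inter_of_injOn _ _ (hf.mono (Set.union_subset hU.1 (hU.2 τ hτ)))).symm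
    have hcard : ∀ ρ ⊆ σ, #(ρ.image f) = #ρ := fun ρ hρ =>
      card_image_of_injOn (hf.mono ((coe_subset.2 hρ).trans hU.1))
    rw [image_insert]
    refine (ih hU.2).attach (forall_mem_image.2 fun τ hτ => ?_)
    obtain ⟨τ', hτ', hsub, hadj⟩ := ha τ hτ
    refine ⟨τ'.image f, mem_image_of_mem _ hτ', ?_, ?_⟩
    · rw [hinter τ hτ]
      exact image_subset_image hsub
    · rw [hinter τ' hτ', hcard _ inter_subset_left, hcard _ subset_rfl, hadj]

theorem Critical.image {T : Finset (Finset F)} (h : Critical T) (hf : Set.InjOn f U)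
    (hU : ∀ σ ∈ T, (σ : Set F) ⊆ U) : Critical (T.image (Finset.image f)) where
  sized := by
    intro s hs
    obtain ⟨σ, hσ, rfl⟩ := mem_image.1 (mem_coe.1 hs)
    rw [card_image_of_injOn (hf.mono (hU σ hσ)), h.sized hσ]
  not_shelled := by
    intro hS
    have hne : Nonempty F := by
      obtain ⟨σ, hσ⟩ := h.nonempty
      obtain ⟨x, -⟩ := card_pos.1 (by rw [h.sized hσ]; norm_num : 0 < #σ)
      exact ⟨x⟩
    have hg : Set.LeftInvOn (Function.invFunOn f U) f U := hf.leftInvOn_invFunOn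
    have hback := hS.image hg.rightInvOn_image.injOn (forall_mem_image.2 fun σ hσ => by
      rw [coe_image]
      exact Set.image_mono (hU σ hσ))
    rw [image_image, image_congr (g := id), image_id] at hback
    · exact h.not_shelled hback
    · intro σ hσ
      rw [Function.comp_apply, image_image, image_congr (g := id), image_id, id]
      exact fun x hx => hg (hU σ hσ hx)
  shelled_restrict := by
    rintro W ⟨s, hs, hsW⟩
    obtain ⟨ρ, hρ, rfl⟩ := mem_image.1 hs
    have hiff : ∀ σ ∈ T, σ.image f ⊆ W ↔ σ ⊆ {x ∈ T.biUnion id | f x ∈ W} := fun σ hσ => by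
      rw [image_subset_iff]
      exact ⟨fun h x hx => mem_filter.2 ⟨subset_biUnion_of_mem id hσ hx, h x hx⟩,
        fun h x hx => (mem_filter.1 (h hx)).2⟩
    rw [filter_image, filter_congr hiff]
    exact (h.shelled_restrict _ ⟨ρ, hρ, (hiff ρ hρ).not.1 hsW⟩).image hf
      fun σ hσ => hU σ (mem_of_mem_filter σ hσ)

end Image

section CriticalFamilies

variable {E : Type*} [DecidableEq E] {T : Finset (Finset E)}

theorem shelled_of_card_le_four {W : Finset E} (hW : #W ≤ 4) (hT : (T : Set (Finset E)).Sized 3)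
    (hTW : ∀ σ ∈ T, σ ⊆ W) : Shelled T := by
  refine Shelled.empty.of_forall_exists_attaches (empty_subset T) fun S _ hS => ?_
  obtain ⟨σ, hσ, hσS⟩ := exists_of_ssubset hS
  refine ⟨σ, hσ, fun τ hτ => ⟨τ, hτ, inter_subset_right, ?_⟩⟩
  have hτ' := hS.1 hτ
  have hne : ¬ σ ⊆ τ := fun h =>
    hσS (eq_of_subset_of_card_le h (by rw [hT hσ, hT hτ']) ▸ hτ)
  have hlt : #(σ ∩ τ) < #σ := card_lt_card
    ⟨inter_subset_left, fun h => hne (h.trans inter_subset_right)⟩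
  have hunion := card_le_card (union_subset (hTW σ hσ) (hTW τ hτ'))
  have hadd := card_union_add_card_inter σ τ
  have hσ3 := hT hσ
  have hτ3 := hT hτ'
  omega

theorem critical_of_card_le_five {V : Finset E} (hV : #V ≤ 5) (hT : (T : Set (Finset E)).Sized 3)
    (hTV : ∀ σ ∈ T, σ ⊆ V) (hns : ¬ Shelled T) : Critical T := by
  refine ⟨hT, hns, ?_⟩
  rintro W ⟨ρ, hρ, hρW⟩
  have hVW : V ∩ W ⊂ V :=
    ⟨inter_subset_left, fun h => hρW ((hTV ρ hρ).trans (h.trans inter_subset_right))⟩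
  have hcard := card_lt_card hVW
  refine shelled_of_card_le_four (W := V ∩ W) (by omega)
    (hT.mono (coe_subset.2 (filter_subset _ _))) fun σ hσ => ?_
  rw [mem_filter] at hσ
  exact subset_inter (hTV σ hσ.1) hσ.2

theorem critical_pair_of_disjoint {σ τ : Finset E} (hσ : #σ = 3) (hτ : #τ = 3)
    (hd : Disjoint σ τ) : Critical {σ, τ} := by
  refine ⟨?_, not_shelled_pair_of_disjoint (by omega) (by omega) hd, fun W hW => ?_⟩
  · intro ρ hρ
    obtain rfl | rfl := by simpa using hρ
    exacts [hσ, hτ]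
  · obtain ⟨ρ, hρ⟩ : ∃ ρ, {s ∈ ({σ, τ} : Finset (Finset E)) | s ⊆ W} ⊆ {ρ} := by
      obtain ⟨ρ, hρ, hρW⟩ := hW
      obtain rfl | rfl := by simpa using hρ
      · exact ⟨τ, fun s hs => by grind⟩
      · exact ⟨σ, fun s hs => by grind⟩
    obtain h | h := subset_singleton_iff.1 hρ
    · exact h ▸ Shelled.empty
    · exact h ▸ Shelled.empty.attach (attaches_empty ρ)

theorem not_shelled_of_link {u : E} {A B : Finset E} (hcard : ∀ σ ∈ T, 3 ≤ #σ)
    (hA : insert u A ∈ T) (hB : insert u B ∈ T) (hAB : Disjoint A B)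
    (hu : ∀ σ ∈ T, u ∈ σ → σ = insert u A ∨ σ = insert u B) : ¬ Shelled T := by
  intro h
  have exists_mem_sdiff : ∀ C, insert u C ∈ T → ∃ x ∈ C, x ∈ insert u C \ {u} := fun C hC => by
    obtain ⟨x, hx, hxu⟩ := exists_mem_ne (s := insert u C) (by have := hcard _ hC; omega) u
    exact ⟨x, (mem_insert.1 hx).resolve_left hxu, mem_sdiff.2 ⟨hx, by rwa [mem_singleton]⟩⟩
  obtain ⟨x, hxA, hx⟩ := exists_mem_sdiff A hA
  obtain ⟨y, hyB, hy⟩ := exists_mem_sdiff B hB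
  have hxy := h.link_connected (ρ := {u}) (f := (· ∈ A)) (fun σ hσ _ => hcard σ hσ) ?_ _ hA
    (by simp) _ hB (by simp) x hx y hy
  · exact disjoint_left.1 hAB (hxy ▸ hxA) hyB
  · intro σ hσ huσ x hx y hy
    rw [singleton_subset_iff] at huσ
    obtain rfl | rfl := hu σ hσ huσ
    all_goals grind [disjoint_left]

variable {A : Type*} [AddCommGroup A] {φ : E → E → A}

/-- A cocycle of a shelled family is a coboundary, hence vanishes on the edge that closes up a path
on which it vanishes. -/
theorem not_shelled_of_cocycle (hcard : ∀ σ ∈ T, 3 ≤ #σ)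
    (hφ : ∀ σ ∈ T, ∀ x ∈ σ, ∀ y ∈ σ, ∀ z ∈ σ, φ x y + φ y z = φ x z) {x y : E} {l : List E}
    (hl : (x :: l).IsChain fun x y => Joined T x y ∧ φ x y = 0) (hy : y ∈ l)
    (hxy : Joined T x y) (hne : φ x y ≠ 0) : ¬ Shelled T := by
  intro h
  obtain ⟨f, hf⟩ := h.exists_potential hcard hφ
  have hchain : (x :: l).IsChain fun x y => f x = f y := hl.imp fun x y hxy => by
    obtain ⟨⟨σ, hσ, hx, hy⟩, h0⟩ := hxy
    exact (sub_eq_zero.1 ((hf σ hσ x hx y hy).symm.trans h0)).symm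
  have : IsTrans E fun x y => f x = f y := ⟨fun _ _ _ => Eq.trans⟩
  have hfxy : f x = f y := List.rel_of_pairwise_cons (List.isChain_iff_pairwise.1 hchain) hy
  obtain ⟨σ, hσ, hx, hy⟩ := hxy
  exact hne (by rw [hf σ hσ x hx y hy, hfxy, sub_self])

/-- A list in which each member attaches to the members after it. -/
def ShellingList : List (Finset E) → Prop
  | [] => True
  | σ :: l => Attaches l.toFinset σ ∧ ShellingList l

theorem ShellingList.shelled : ∀ {l : List (Finset E)}, ShellingList l → Shelled l.toFinset
  | [], _ => Shelled.empty
  | _ :: _, h => by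
    rw [List.toFinset_cons]
    exact h.2.shelled.attach h.1

instance (S : Finset (Finset E)) (σ : Finset E) : Decidable (Attaches S σ) := by
  unfold Attaches
  infer_instance

instance decidableShellingList : ∀ l : List (Finset E), Decidable (ShellingList l)
  | [] => isTrue trivial
  | _ :: l => @instDecidableAnd _ _ _ (decidableShellingList l)

theorem critical_of_shellingList (hT : (T : Set (Finset E)).Sized 3) (hns : ¬ Shelled T)
    {l : List (Finset E)} (hl : l.toFinset = T)
    (hW : ∀ W : Finset E, 5 ≤ #W → (∃ σ ∈ T, ¬ σ ⊆ W) →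
      ∃ l' ∈ l.cyclicPermutations, ShellingList (l'.filter (· ⊆ W))) : Critical T := by
  refine ⟨hT, hns, fun W hTW => ?_⟩
  by_cases h5 : 5 ≤ #W
  · obtain ⟨l', hl', hshell⟩ := hW W h5 hTW
    have hperm : l'.toFinset = T := hl ▸
      List.toFinset_eq_of_perm _ _ (List.mem_cyclicPermutations_iff.1 hl').perm
    simpa only [List.toFinset_filter, hperm, decide_eq_true_eq] using hshell.shelled
  · exact shelled_of_card_le_four (W := W) (by omega)
      (hT.mono (coe_subset.2 (filter_subset _ _))) fun σ hσ => (mem_filter.1 hσ).2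

end CriticalFamilies

section MinimalModel

variable {E F : Type*} [DecidableEq E] {Γ₀ Γ : FinComplex E} {Δ : FinComplex F}

/-- Combinatorial conditions under which a complex is an edge-minimal obstruction, and all complexes
obtained from it by adding edges are obstructions: its triangles are those of an obstruction, no
edges can be added to form an induced `2K₂`, and removing edges outside the triangles leaves an
induced `2K₂`. -/
structure IsMinimalModel (Γ : FinComplex E) : Prop where
  card_le : ∀ s ∈ Γ.faces, #s ≤ 3
  critical : Critical Γ.triangles
  joined_self : ∀ v ∈ Γ.vertexSet, Joined Γ.triangles v v
  cross : ∀ a ∈ Γ.vertexSet, ∀ c ∈ Γ.vertexSet, {a, c} ∉ Γ.faces →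
    ∀ d ∈ Γ.vertexSet, d ≠ c → {a, d} ∉ Γ.faces →
      ∀ b ∈ Γ.vertexSet, b ≠ a → {b, c} ∈ Γ.faces ∨ {b, d} ∈ Γ.faces
  needed : ∀ x y, x ≠ y → {x, y} ∈ Γ.faces → Joined Γ.triangles x y ∨
    ∃ b d, x ≠ b ∧ y ≠ d ∧ Joined Γ.triangles x b ∧ Joined Γ.triangles y d ∧
      {x, d} ∉ Γ.faces ∧ {b, y} ∉ Γ.faces ∧ {b, d} ∉ Γ.faces

theorem Joined.pair_mem {x y : E} (h : Joined Γ.triangles x y) : {x, y} ∈ Γ.faces := by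
  obtain ⟨t, ht, hx, hy⟩ := h
  exact pair_mem_faces (mem_triangles.1 ht).1 hx hy

theorem joined_image {T : Finset (Finset F)} {f : F → E} {x y : F} (h : Joined T x y) :
    Joined (T.image (image f)) (f x) (f y) := by
  obtain ⟨t, ht, hx, hy⟩ := h
  exact ⟨_, mem_image_of_mem _ ht, mem_image_of_mem f hx, mem_image_of_mem f hy⟩

variable [DecidableEq F]

theorem IsMinimalModel.map (h : Δ.IsMinimalModel) {f : F → E} (hf : Set.InjOn f Δ.vertexSet) :
    (Δ.map f).IsMinimalModel where
  card_le := by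
    intro s hs
    obtain ⟨u, hu, rfl⟩ := mem_map.1 hs
    exact card_image_le.trans (h.card_le u hu)
  critical := by
    rw [triangles_map hf]
    exact h.critical.image hf fun σ hσ => coe_subset_vertexSet (mem_triangles.1 hσ).1
  joined_self := by
    rw [vertexSet_map, triangles_map hf]
    rintro _ ⟨v, hv, rfl⟩
    exact joined_image (h.joined_self v hv)
  cross := by
    rw [vertexSet_map]
    rintro _ ⟨a, ha, rfl⟩ _ ⟨c, hc, rfl⟩ hac _ ⟨d, hd, rfl⟩ hdc had _ ⟨b, hb, rfl⟩ hba
    rw [pair_mem_map hf ha hc] at hac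
    rw [pair_mem_map hf ha hd] at had
    rw [pair_mem_map hf hb hc, pair_mem_map hf hb hd]
    exact h.cross a ha c hc hac d hd (ne_of_apply_ne f hdc) had b hb (ne_of_apply_ne f hba)
  needed := by
    intro x y hxy hmem
    have hx := mem_vertexSet_of_mem hmem (mem_insert_self x {y})
    have hy := mem_vertexSet_of_mem hmem (mem_insert_of_mem (mem_singleton_self y))
    rw [vertexSet_map] at hx hy
    obtain ⟨x, hx, rfl⟩ := hx
    obtain ⟨y, hy, rfl⟩ := hy
    rw [pair_mem_map hf hx hy] at hmem
    rw [triangles_map hf]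
    refine (h.needed x y (ne_of_apply_ne f hxy) hmem).imp joined_image ?_
    rintro ⟨b, d, hxb, hyd, hxb', hyd', hxd, hby, hbd⟩
    have hb := mem_vertexSet_of_mem hxb'.pair_mem (mem_insert_of_mem (mem_singleton_self b))
    have hd := mem_vertexSet_of_mem hyd'.pair_mem (mem_insert_of_mem (mem_singleton_self d))
    refine ⟨f b, f d, hf.ne hx hb hxb, hf.ne hy hd hyd, joined_image hxb', joined_image hyd', ?_⟩
    rw [pair_mem_map hf hx hd, pair_mem_map hf hb hy, pair_mem_map hf hb hd]
    exact ⟨hxd, hby, hbd⟩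

theorem IsMinimalModel.isObstruction_of_isAddEdges (h₀ : Γ₀.IsMinimalModel)
    (h : IsAddEdges Γ₀ Γ) : Γ.IsObstruction ∧ Γ.dim = 2 := by
  have hcrit : Critical Γ.triangles := h.triangles_eq ▸ h₀.critical
  have hd : Γ.dim = 2 := dim_eq_two_iff.2 ⟨h.card_le h₀.card_le, hcrit.nonempty⟩
  refine ⟨(isObstruction_iff_of_dim_eq_two hd).2 ⟨fun a b c d hK => ?_, hcrit, fun v hv => ?_⟩, hd⟩
  · have hV : ∀ {s : Finset E}, s ∈ Γ.faces → ∀ x ∈ s, x ∈ Γ₀.vertexSet := fun hs x hx =>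
      h.vertexSet_eq ▸ mem_vertexSet_of_mem hs hx
    have hcross : ∀ x ∈ ({a, b} : Finset E), ∀ y ∈ ({c, d} : Finset E), {x, y} ∉ Γ₀.faces :=
      fun x hx y hy hxy => hK.cross_notMem x hx y hy (h.1 hxy)
    obtain hbc | hbd := h₀.cross a (hV hK.left_mem a (by simp)) c (hV hK.right_mem c (by simp))
      (hcross a (by simp) c (by simp)) d (hV hK.right_mem d (by simp)) hK.right_ne.symm
      (hcross a (by simp) d (by simp)) b (hV hK.left_mem b (by simp)) hK.left_ne.symm
    · exact hcross b (by simp) c (by simp) hbc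
    · exact hcross b (by simp) d (by simp) hbd
  · rw [h.vertexSet_eq] at hv
    obtain ⟨σ, hσ, hvσ, -⟩ := h₀.joined_self v hv
    exact ⟨σ, h.triangles_eq ▸ hσ, hvσ⟩

theorem IsMinimalModel.eq_of_isAddEdges (h : Γ.IsMinimalModel) (hΓ₀ : Γ₀.IsObstruction)
    (hd : Γ₀.dim = 2) (hadd : IsAddEdges Γ₀ Γ) : Γ₀ = Γ := by
  refine FinComplex.ext (hadd.1.antisymm fun s hs => ?_)
  by_contra hs₀
  have hcard : #s = 2 := by
    by_contra h2
    exact hs₀ ((hadd.mem_iff h2).1 hs)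
  obtain ⟨x, y, hxy, rfl⟩ := card_eq_two.1 hcard
  have hneeded := h.needed x y hxy hs
  rw [hadd.triangles_eq] at hneeded
  obtain hxy' | ⟨b, d, hxb, hyd, hxb', hyd', hxd, hby, hbd⟩ := hneeded
  · exact hs₀ hxy'.pair_mem
  · refine hΓ₀.twoK2Free hd x b y d ⟨hxb, hyd, hxb'.pair_mem, hyd'.pair_mem, ?_⟩
    simp only [mem_insert, mem_singleton, forall_eq_or_imp, forall_eq]
    exact ⟨⟨hs₀, fun h => hxd (hadd.1 h)⟩, fun h => hby (hadd.1 h), fun h => hbd (hadd.1 h)⟩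

theorem isMinimalModel_generatedBy {F : Finset (Finset E)} (hcard : ∀ t ∈ F, #t ≤ 3)
    (hcrit : Critical {t ∈ F | #t = 3})
    (hself : ∀ v, Joined F v v → Joined {t ∈ F | #t = 3} v v)
    (hcross : ∀ a, Joined F a a → ∀ c, Joined F c c → ¬ Joined F a c → ∀ d, Joined F d d → d ≠ c →
      ¬ Joined F a d → ∀ b, Joined F b b → b ≠ a → Joined F b c ∨ Joined F b d)
    (hneeded : ∀ x y, x ≠ y → Joined F x y → Joined {t ∈ F | #t = 3} x y ∨
      ∃ b d, x ≠ b ∧ y ≠ d ∧ Joined {t ∈ F | #t = 3} x b ∧ Joined {t ∈ F | #t = 3} y d ∧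
        ¬ Joined F x d ∧ ¬ Joined F b y ∧ ¬ Joined F b d) : (generatedBy F).IsMinimalModel := by
  rw [← triangles_generatedBy hcard] at hcrit hself hneeded
  simp only [← mem_vertexSet_generatedBy] at hcross
  simp only [← pair_mem_generatedBy (F := F)] at hcross hneeded
  refine ⟨fun s hs => ?_, hcrit,
    fun v hv => hself v (mem_vertexSet_generatedBy.1 hv), hcross, hneeded⟩
  obtain rfl | ⟨t, ht, hst⟩ := mem_generatedBy.1 hs
  exacts [Nat.zero_le 3, (card_le_card hst).trans (hcard t ht)]

end MinimalModel

section TwelveComplexes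

/-- The value 1 marks the edges of a band on `0, …, n - 1` that pass from the end of this list to
its beginning. On bands this is a cocycle. -/
def winding (x y : Fin 7) : ZMod 2 := if x.val + 3 ≤ y.val ∨ y.val + 3 ≤ x.val then 1 else 0

theorem critical_of_two_disjoint {T : Finset (Finset (Fin 7))}
    (hT : T = {{0, 1, 2}, {3, 4, 5}}) : Critical T :=
  hT ▸ critical_pair_of_disjoint rfl rfl (by decide)

theorem critical_of_link {T : Finset (Finset (Fin 7))} (hT : ∀ σ ∈ T, #σ = 3)
    (hTV : ∀ σ ∈ T, σ ⊆ {0, 1, 2, 3, 4}) (h012 : {0, 1, 2} ∈ T) (h034 : {0, 3, 4} ∈ T)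
    (h0 : ∀ σ ∈ T, 0 ∈ σ → σ = {0, 1, 2} ∨ σ = {0, 3, 4}) : Critical T :=
  critical_of_card_le_five (V := {0, 1, 2, 3, 4}) (by decide) (fun σ hσ => hT σ hσ) hTV
    (not_shelled_of_link (fun σ hσ => (hT σ hσ).ge) h012 h034 (by decide) h0)

theorem isMinimalModel_of_mem_twelveComplexes {Δ : FinComplex (Fin 7)}
    (h : Δ ∈ twelveComplexes) : Δ.IsMinimalModel := by
  simp only [twelveComplexes, List.mem_cons, List.not_mem_nil, or_false] at h
  rcases h with rfl | rfl | rfl | rfl | rfl | rfl | rfl | rfl | rfl | rfl | rfl | rfl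
  all_goals
    refine isMinimalModel_generatedBy (by decide +kernel) ?_ (by decide +kernel)
      (by decide +kernel) (by decide +kernel)
  iterate 3 exact critical_of_two_disjoint (by decide +kernel)
  iterate 6 refine critical_of_link ?_ ?_ ?_ ?_ ?_ <;> decide +kernel
  · refine critical_of_card_le_five (V := {0, 1, 2, 3, 4}) (by decide)
      (fun _ h => (mem_filter.1 h).2) ?_ (not_shelled_of_cocycle (φ := winding) (x := 0) (y := 4)
        (l := [1, 2, 3, 4]) ?_ ?_ ?_ ?_ ?_ ?_) <;> decide +kernel
  · refine critical_of_shellingList (fun _ h => (mem_filter.1 h).2)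
      (not_shelled_of_cocycle (φ := winding) (x := 0) (y := 5)
        (l := [1, 2, 3, 4, 5]) ?_ ?_ ?_ ?_ ?_ ?_)
      (l := [{0, 1, 2}, {1, 2, 3}, {2, 3, 4}, {3, 4, 5}, {4, 5, 0}, {5, 0, 1}]) ?_ ?_ <;>
        decide +kernel
  · refine critical_of_shellingList (fun _ h => (mem_filter.1 h).2)
      (not_shelled_of_cocycle (φ := winding) (x := 0) (y := 6)
        (l := [1, 2, 3, 4, 5, 6]) ?_ ?_ ?_ ?_ ?_ ?_)
      (l := [{0, 1, 2}, {1, 2, 3}, {2, 3, 4}, {3, 4, 5}, {4, 5, 6}, {5, 6, 0}, {6, 0, 1}])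
      ?_ ?_ <;> decide +kernel

end TwelveComplexes

section ContainsMinimal

variable {E : Type*} [DecidableEq E] {Γ₀ Γ : FinComplex E}

/-- `Γ` is one of the twelve complexes with edges added. -/
def ContainsMinimal (Γ : FinComplex E) : Prop :=
  ∃ Δ ∈ twelveComplexes, ∃ Γ₀ : FinComplex E, Γ₀.IsIso Δ ∧ IsAddEdges Γ₀ Γ

theorem IsObstruction.isAddEdges (h : Γ.IsObstruction) (hd : Γ.dim = 2)
    (hsub : Γ₀.faces ⊆ Γ.faces) (hT : Γ.triangles ⊆ Γ₀.triangles) : IsAddEdges Γ₀ Γ := by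
  refine ⟨hsub, fun s hs hs₀ => ?_⟩
  have hle : #s ≤ 3 := (dim_eq_two_iff.1 hd).1 s hs
  have h3 : #s ≠ 3 := fun h3 => hs₀ (mem_triangles.1 (hT (mem_triangles.2 ⟨hs, h3⟩))).1
  have h1 : #s ≠ 1 := fun h1 => by
    obtain ⟨v, rfl⟩ := card_eq_one.1 h1
    obtain ⟨σ, hσ, hv⟩ := ((isObstruction_iff_of_dim_eq_two hd).1 h).2.2 v hs
    exact hs₀ (mem_vertexSet_of_mem (mem_triangles.1 (hT hσ)).1 hv)
  have h0 : #s ≠ 0 := fun h0 => hs₀ (card_eq_zero.1 h0 ▸ Γ₀.empty_mem)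
  rw [faceDim]
  omega

theorem IsObstruction.containsMinimal_of_injOn (h : Γ.IsObstruction) (hd : Γ.dim = 2)
    {F : Finset (Finset (Fin 7))} (hF : generatedBy F ∈ twelveComplexes) {V : Finset (Fin 7)}
    (hFV : ∀ t ∈ F, t ⊆ V) {f : Fin 7 → E} (hf : Set.InjOn f V)
    (hfaces : ∀ t ∈ F, t.image f ∈ Γ.faces) (hcard : #Γ.triangles ≤ #{t ∈ F | #t = 3}) :
    Γ.ContainsMinimal := by
  have hV : (generatedBy F).vertexSet ⊆ V := by
    intro x hx
    obtain ⟨t, ht, hxt, -⟩ := mem_vertexSet_generatedBy.1 hx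
    exact hFV t ht hxt
  have hsub : ((generatedBy F).map f).faces ⊆ Γ.faces := by
    intro s hs
    obtain ⟨u, hu, rfl⟩ := mem_map.1 hs
    obtain rfl | ⟨t, ht, hut⟩ := mem_generatedBy.1 hu
    · exact Γ.empty_mem
    · exact Γ.down_closed _ (hfaces t ht) _ (image_subset_image hut)
  have hT : ((generatedBy F).map f).triangles = Γ.triangles := by
    refine eq_of_subset_of_card_le (filter_subset_filter _ hsub) ?_
    rw [triangles_map (hf.mono hV), card_image_of_injOn]
    · refine hcard.trans (card_le_card fun t ht => ?_)
      obtain ⟨ht, h3⟩ := mem_filter.1 ht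
      exact mem_triangles.2 ⟨mem_generatedBy.2 (Or.inr ⟨t, ht, subset_rfl⟩), h3⟩
    · intro s hs t ht hst
      have himage : f '' s = f '' t := by rw [← coe_image, ← coe_image, hst]
      exact coe_injective (((hf.mono hV).image_eq_image_iff
        (coe_subset_vertexSet (mem_triangles.1 hs).1)
        (coe_subset_vertexSet (mem_triangles.1 ht).1)).1 himage)
  exact ⟨_, hF, _, isIso_map (hf.mono hV), h.isAddEdges hd hsub hT.ge⟩

theorem IsObstruction.containsMinimal_of_nodup (h : Γ.IsObstruction) (hd : Γ.dim = 2)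
    {F : Finset (Finset (Fin 7))} (hF : generatedBy F ∈ twelveComplexes) {l : List E}
    (hl : l.Nodup) (e : E) (hlen : ∀ t ∈ F, ∀ i ∈ t, i.val < l.length)
    (hfaces : ∀ t ∈ F, t.image (fun i => l.getD i.val e) ∈ Γ.faces)
    (hcard : #Γ.triangles ≤ #{t ∈ F | #t = 3}) : Γ.ContainsMinimal := by
  refine h.containsMinimal_of_injOn hd hF (V := {i | i.val < l.length})
    (fun t ht i hi => mem_filter.2 ⟨mem_univ i, hlen t ht i hi⟩) (fun i hi j hj hij => ?_)
    hfaces hcard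
  rw [mem_coe, mem_filter_univ] at hi hj
  rw [List.getD_eq_getElem _ _ hi, List.getD_eq_getElem _ _ hj] at hij
  exact Fin.ext (hl.getElem_inj_iff.1 hij)

theorem IsObstruction.containsMinimal_of_isBand (h : Γ.IsObstruction) (hd : Γ.dim = 2) {n : ℕ}
    (hB : IsBand Γ.triangles n) {F : Finset (Finset (Fin 7))} (hF : generatedBy F ∈ twelveComplexes)
    (hFn : ∀ t ∈ F, ∃ i < n, t.image Fin.val = {i % n, (i + 1) % n, (i + 2) % n})
    (hcard : n ≤ #{t ∈ F | #t = 3}) : Γ.ContainsMinimal := by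
  obtain ⟨s, hper, hs, hT⟩ := hB
  refine h.containsMinimal_of_injOn hd hF (V := {i | i.val < n}) (f := s ∘ Fin.val)
    (fun t ht x hx => ?_) (fun i hi j hj hij => ?_) (fun t ht => ?_)
    (hT ▸ card_image_le.trans (by rwa [card_range]))
  · obtain ⟨i, hi, ht⟩ := hFn t ht
    have hx : x.val ∈ t.image Fin.val := mem_image_of_mem _ hx
    have hlt := fun k => Nat.mod_lt k (Nat.zero_lt_of_lt hi)
    simp only [ht, mem_insert, mem_singleton] at hx
    rw [mem_filter_univ]
    obtain hx | hx | hx := hx <;> exact hx ▸ hlt _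
  · rw [mem_coe, mem_filter_univ] at hi hj
    exact Fin.ext (hs hi hj hij)
  · obtain ⟨i, hi, ht⟩ := hFn t ht
    have himage : t.image (s ∘ Fin.val) = {s i, s (i + 1), s (i + 2)} := by
      rw [← image_image, ht]
      simp only [image_insert, image_singleton, hper.map_mod_nat]
    rw [himage]
    exact (mem_triangles.1 (hT ▸ mem_image_of_mem _ (mem_range.2 hi))).1

theorem IsObstruction.containsMinimal_of_isBand_five_six_seven (h : Γ.IsObstruction)
    (hd : Γ.dim = 2) (hB : IsBand Γ.triangles 5 ∨ IsBand Γ.triangles 6 ∨ IsBand Γ.triangles 7) :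
    Γ.ContainsMinimal := by
  obtain hB | hB | hB := hB
  · exact h.containsMinimal_of_isBand hd hB (show complex4a ∈ _ by simp [twelveComplexes])
      (by decide +kernel) (by decide +kernel)
  · exact h.containsMinimal_of_isBand hd hB (show complex4b ∈ _ by simp [twelveComplexes])
      (by decide +kernel) (by decide +kernel)
  · exact h.containsMinimal_of_isBand hd hB (show complex4c ∈ _ by simp [twelveComplexes])
      (by decide +kernel) (by decide +kernel)

end ContainsMinimal

section TwoDisjoint

variable {E : Type*} [DecidableEq E] {Γ : FinComplex E} {σ τ : Finset E}

theorem TwoK2Free.exists_injective_or_isolated (hG : Γ.TwoK2Free) (hσ : σ ∈ Γ.faces)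
    (hτ : τ ∈ Γ.faces) (hσ3 : #σ = 3) (hτ3 : #τ = 3) :
    (∃ f : σ → E, f.Injective ∧ ∀ x, f x ∈ τ ∧ {x.val, f x} ∈ Γ.faces) ∨
      (∃ x ∈ σ, ∀ y ∈ τ, {x, y} ∉ Γ.faces) ∨ ∃ y ∈ τ, ∀ x ∈ σ, {x, y} ∉ Γ.faces := by
  let N (x : σ) : Finset E := {y ∈ τ | {x.val, y} ∈ Γ.faces}
  by_cases hall : ∀ S : Finset σ, #S ≤ #(S.biUnion N)
  · obtain ⟨f, hf, hfN⟩ := (all_card_le_biUnion_card_iff_exists_injective N).1 hall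
    exact Or.inl ⟨f, hf, fun x => mem_filter.1 (hfN x)⟩
  obtain ⟨S, hS⟩ := not_forall.1 hall
  right
  have hnot : ∀ x ∈ S, ∀ y ∈ τ \ S.biUnion N, {x.val, y} ∉ Γ.faces := fun x hx y hy hxy =>
    (mem_sdiff.1 hy).2 (mem_biUnion.2 ⟨x, hx, mem_filter.2 ⟨(mem_sdiff.1 hy).1, hxy⟩⟩)
  have hN : #(τ \ S.biUnion N) + #(S.biUnion N) = 3 :=
    hτ3 ▸ card_sdiff_add_card_eq_card (biUnion_subset.2 fun x _ => filter_subset _ _)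
  obtain hS1 | hS2 := Nat.lt_or_ge #S 2
  · obtain ⟨x, rfl⟩ := card_eq_one.1 (show #S = 1 by omega)
    have hτN : τ \ Finset.biUnion {x} N = τ := eq_of_subset_of_card_le sdiff_subset (by
      rw [card_singleton] at hS
      omega)
    exact Or.inl ⟨x, x.2, fun y hy => hnot x (mem_singleton_self x) y (hτN.symm ▸ hy)⟩
  obtain hτ1 | hτ2 := Nat.lt_or_ge #(τ \ S.biUnion N) 2
  · have hSuniv : S = univ := eq_univ_of_card S (le_antisymm (card_le_univ S) (by
      rw [Fintype.card_coe]
      omega))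
    have hle : #S ≤ 3 := by simpa [hσ3] using card_le_univ S
    obtain ⟨y, hy⟩ := card_pos.1 (show 0 < #(τ \ S.biUnion N) by omega)
    exact Or.inr ⟨y, (mem_sdiff.1 hy).1, fun x hx => hnot ⟨x, hx⟩ (hSuniv ▸ mem_univ _) y hy⟩
  · obtain ⟨x, hx, x', hx', hxx'⟩ := one_lt_card.1 hS2
    obtain ⟨y, hy, y', hy', hyy'⟩ := one_lt_card.1 hτ2
    refine absurd ⟨fun h => hxx' (Subtype.ext h), hyy', pair_mem_faces hσ x.2 x'.2,
      pair_mem_faces hτ (mem_sdiff.1 hy).1 (mem_sdiff.1 hy').1, ?_⟩ (hG x x' y y')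
    simp only [mem_insert, mem_singleton, forall_eq_or_imp, forall_eq]
    exact ⟨⟨hnot x hx y hy, hnot x hx y' hy'⟩, hnot x' hx' y hy, hnot x' hx' y' hy'⟩

theorem TwoK2Free.exists_forall_ne_pair_mem (hG : Γ.TwoK2Free) (hσ : σ ∈ Γ.faces)
    (hne : σ.Nonempty) {q r : E} (hqr : q ≠ r) (hqr' : {q, r} ∈ Γ.faces)
    (hr : ∀ x ∈ σ, {x, r} ∉ Γ.faces) : ∃ x ∈ σ, ∀ y ∈ σ, y ≠ x → {y, q} ∈ Γ.faces := by
  by_cases hq : ∀ y ∈ σ, {y, q} ∈ Γ.faces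
  · obtain ⟨x, hx⟩ := hne
    exact ⟨x, hx, fun y hy _ => hq y hy⟩
  push Not at hq
  obtain ⟨x, hx, hxq⟩ := hq
  refine ⟨x, hx, fun y hy hyx => by_contra fun hyq => ?_⟩
  refine hG y x q r ⟨hyx, hqr, pair_mem_faces hσ hy hx, hqr', ?_⟩
  simp only [mem_insert, mem_singleton, forall_eq_or_imp, forall_eq]
  exact ⟨⟨hyq, hr y hy⟩, hxq, hr x hx⟩

theorem triple_rotate (a b c : E) : ({a, b, c} : Finset E) = {b, c, a} := by
  rw [insert_comm, pair_comm]

theorem nodup_of_disjoint {a b c x y z : E} (hσ : #{a, b, c} = 3) (hτ : #{x, y, z} = 3)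
    (h : Disjoint ({a, b, c} : Finset E) {x, y, z}) : [a, b, c, x, y, z].Nodup := by
  rw [card_triple_eq_three_iff] at hσ hτ
  simp only [disjoint_left, mem_insert, mem_singleton, forall_eq_or_imp, forall_eq, not_or] at h
  simp only [List.nodup_cons, List.mem_cons, List.not_mem_nil, or_false, not_or, List.nodup_nil]
  tauto

theorem IsObstruction.containsMinimal_of_disjoint (h : Γ.IsObstruction) (hd : Γ.dim = 2)
    {x y z s t r : E} (hT : Γ.triangles = {{x, y, z}, {s, t, r}})
    (hdisj : Disjoint ({x, y, z} : Finset E) {s, t, r}) {F : Finset (Finset (Fin 7))}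
    (hF : generatedBy (insert {0, 1, 2} (insert {3, 4, 5} F)) ∈ twelveComplexes)
    (hF6 : ∀ t ∈ F, ∀ i ∈ t, i.val < 6)
    (hfaces : ∀ e ∈ F, e.image (fun i => [x, y, z, s, t, r].getD i.val x) ∈ Γ.faces) :
    Γ.ContainsMinimal := by
  obtain ⟨hσ, hσ3⟩ := mem_triangles.1 (hT ▸ mem_insert_self {x, y, z} {{s, t, r}})
  obtain ⟨hτ, hτ3⟩ := mem_triangles.1 (hT ▸ mem_insert_of_mem (mem_singleton_self {s, t, r}))
  refine h.containsMinimal_of_nodup hd hF (nodup_of_disjoint hσ3 hτ3 hdisj) x ?_ ?_ ?_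
  · exact (forall_mem_insert _ _ _).2 ⟨by simp, (forall_mem_insert _ _ _).2 ⟨by simp, hF6⟩⟩
  · simp only [forall_mem_insert, image_insert, image_singleton]
    exact ⟨hσ, hτ, hfaces⟩
  · rw [hT]
    refine card_le_two.trans ((card_pair (a := ({0, 1, 2} : Finset (Fin 7))) (b := {3, 4, 5})
      (by decide)).ge.trans (card_le_card ?_))
    simp [insert_subset_iff]

theorem IsObstruction.containsMinimal_of_injective (h : Γ.IsObstruction) (hd : Γ.dim = 2)
    (hT : Γ.triangles = {σ, τ}) (hdisj : Disjoint σ τ) {f : σ → E} (hf : f.Injective)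
    (hfτ : ∀ x, f x ∈ τ ∧ {x.val, f x} ∈ Γ.faces) : Γ.ContainsMinimal := by
  have hσ3 := (mem_triangles.1 (hT ▸ mem_insert_self σ {τ})).2
  have hτ3 := (mem_triangles.1 (hT ▸ mem_insert_of_mem (mem_singleton_self τ))).2
  obtain ⟨x, y, z, hxy, hxz, hyz, rfl⟩ := card_eq_three.1 hσ3
  let x' : ({x, y, z} : Finset E) := ⟨x, by simp⟩
  let y' : ({x, y, z} : Finset E) := ⟨y, by simp⟩
  let z' : ({x, y, z} : Finset E) := ⟨z, by simp⟩
  have hcard : #{f x', f y', f z'} = 3 := card_triple_eq_three_iff.2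
    ⟨hf.ne (by simpa [x', y']), hf.ne (by simpa [x', z']), hf.ne (by simpa [y', z'])⟩
  obtain rfl : {f x', f y', f z'} = τ := eq_of_subset_of_card_le
    (by simp only [insert_subset_iff, singleton_subset_iff, (hfτ _).1, and_self]) (by omega)
  refine h.containsMinimal_of_disjoint hd hT hdisj (show complex1a ∈ _ by simp [twelveComplexes])
    (by decide +kernel) ?_
  simp only [forall_mem_insert, mem_singleton, forall_eq, image_insert, image_singleton]
  exact ⟨(hfτ x').2, (hfτ y').2, (hfτ z').2⟩

/-- Each of the two vertices of `τ` other than `r` has at most one non-neighbour in `σ`. If these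
non-neighbours coincide, the edges form a 4-cycle, otherwise a path. -/
theorem IsObstruction.containsMinimal_of_isolated (h : Γ.IsObstruction) (hd : Γ.dim = 2)
    (hT : Γ.triangles = {σ, τ}) (hdisj : Disjoint σ τ) {r : E} (hrτ : r ∈ τ)
    (hr : ∀ x ∈ σ, {x, r} ∉ Γ.faces) : Γ.ContainsMinimal := by
  have hG := h.twoK2Free hd
  have hσT : σ ∈ Γ.triangles := hT ▸ mem_insert_self σ {τ}
  have hτT : τ ∈ Γ.triangles := hT ▸ mem_insert_of_mem (mem_singleton_self τ)
  obtain ⟨hσ, hσ3⟩ := mem_triangles.1 hσT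
  have hne : σ.Nonempty := card_pos.1 (by omega)
  obtain ⟨s, t, hrst, hτ⟩ := exists_tri_of_mem sized_triangles hτT hrτ
  obtain rfl : τ = {s, t, r} := hτ.trans (triple_rotate r s t)
  obtain ⟨hrs, hrt, -⟩ := hrst.ne sized_triangles
  obtain ⟨u, hu, hus⟩ := hG.exists_forall_ne_pair_mem hσ hne hrs.symm
    (pair_mem_faces (mem_triangles.1 hτT).1 (by simp) (by simp)) hr
  obtain ⟨v, hv, hvt⟩ := hG.exists_forall_ne_pair_mem hσ hne hrt.symm
    (pair_mem_faces (mem_triangles.1 hτT).1 (by simp) (by simp)) hr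
  by_cases huv : u = v
  · subst huv
    obtain ⟨x, y, huxy, hσ'⟩ := exists_tri_of_mem sized_triangles hσT hu
    obtain rfl : σ = {x, y, u} := hσ'.trans (triple_rotate u x y)
    obtain ⟨hux, huy, -⟩ := huxy.ne sized_triangles
    refine h.containsMinimal_of_disjoint hd hT hdisj
      (show complex1c ∈ _ by simp [twelveComplexes]) (by decide +kernel) ?_
    simp only [forall_mem_insert, mem_singleton, forall_eq, image_insert, image_singleton]
    exact ⟨hus x (by simp) hux.symm, hus y (by simp) huy.symm,
      hvt y (by simp) huy.symm, hvt x (by simp) hux.symm⟩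
  · obtain ⟨w, huvw, hσ'⟩ := exists_tri_of_mem_of_mem sized_triangles hσT hu hv huv
    obtain rfl : σ = {w, u, v} := hσ'.trans (triple_rotate w u v).symm
    obtain ⟨-, huw, hvw⟩ := huvw.ne sized_triangles
    refine h.containsMinimal_of_disjoint hd hT hdisj
      (show complex1b ∈ _ by simp [twelveComplexes]) (by decide +kernel) ?_
    simp only [forall_mem_insert, mem_singleton, forall_eq, image_insert, image_singleton]
    exact ⟨hus v (by simp) (Ne.symm huv), hus w (by simp) huw.symm,
      hvt w (by simp) hvw.symm, hvt u (by simp) huv⟩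

theorem IsObstruction.containsMinimal_of_twoDisjoint (h : Γ.IsObstruction) (hd : Γ.dim = 2)
    (hD : TwoDisjoint Γ.triangles) : Γ.ContainsMinimal := by
  obtain ⟨σ, τ, hdisj, hT⟩ := hD
  obtain ⟨hσ, hσ3⟩ := mem_triangles.1 (hT ▸ mem_insert_self σ {τ})
  obtain ⟨hτ, hτ3⟩ := mem_triangles.1 (hT ▸ mem_insert_of_mem (mem_singleton_self τ))
  obtain ⟨f, hf, hfτ⟩ | ⟨x, hx, hxτ⟩ | ⟨y, hy, hyσ⟩ :=
    (h.twoK2Free hd).exists_injective_or_isolated hσ hτ hσ3 hτ3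
  · exact h.containsMinimal_of_injective hd hT hdisj hf hfτ
  · exact h.containsMinimal_of_isolated hd (hT.trans (pair_comm σ τ)) hdisj.symm hx
      fun y hy => pair_comm x y ▸ hxτ y hy
  · exact h.containsMinimal_of_isolated hd hT hdisj hy hyσ

end TwoDisjoint

section LinkPair

variable {E : Type*} [DecidableEq E] {T : Finset (Finset E)} {Γ : FinComplex E} {u a b c d : E}

/-- The triangles of `T` live on five vertices `u`, `a`, `b`, `c`, `d`, and the link of `u` consists
of the two disjoint edges `ab` and `cd`. -/
structure IsLinkPair (T : Finset (Finset E)) (u a b c d : E) : Prop where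
  nodup : [u, a, b, c, d].Nodup
  left : Tri T u a b
  right : Tri T u c d
  subset : ∀ σ ∈ T, σ ⊆ {u, a, b, c, d}
  eq_or_eq : ∀ σ ∈ T, u ∈ σ → σ = {u, a, b} ∨ σ = {u, c, d}

theorem Critical.isLinkPair (h : Critical T) (hab : Tri T u a b) (hcd : Tri T u c d) (hac : a ≠ c)
    (had : a ≠ d) (hbc : b ≠ c) (hbd : b ≠ d)
    (hn : ¬ (Tri T u a c ∨ Tri T u a d ∨ Tri T u b c ∨ Tri T u b d)) : IsLinkPair T u a b c d := by
  obtain ⟨hua, hub, hab'⟩ := hab.ne h.sized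
  obtain ⟨huc, hud, hcd'⟩ := hcd.ne h.sized
  have hsub := h.subset_of_link hab hcd hac hbc hn
  refine ⟨by simp [*], hab, hcd, hsub, fun σ hσ huσ => ?_⟩
  obtain ⟨p, q, hpq, rfl⟩ := exists_tri_of_mem h.sized hσ huσ
  obtain ⟨hup, huq, hpq'⟩ := hpq.ne h.sized
  have hcross : ∀ x ∈ ({a, b} : Finset E), ∀ y ∈ ({c, d} : Finset E), ¬ Tri T u x y := by
    simpa [not_or, and_assoc] using hn
  have hmem : ∀ x ∈ ({u, p, q} : Finset E), u ≠ x →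
      x ∈ ({a, b} : Finset E) ∨ x ∈ ({c, d} : Finset E) := by
    intro x hx hux
    have := hsub _ hσ hx
    simp only [mem_insert, mem_singleton, hux.symm, false_or] at this ⊢
    rwa [or_assoc]
  have heq : ∀ x y : E, p ∈ ({x, y} : Finset E) → q ∈ ({x, y} : Finset E) →
      ({u, p, q} : Finset E) = {u, x, y} := fun x y hp hq => congrArg (insert u)
    (eq_of_subset_of_card_le (insert_subset hp (singleton_subset_iff.2 hq))
      (card_le_two.trans (card_pair hpq').ge))
  obtain hp | hp := hmem p (by simp) hup <;> obtain hq | hq := hmem q (by simp) huq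
  · exact Or.inl (heq a b hp hq)
  · exact absurd hpq (hcross p hp q hq)
  · exact absurd hpq.swap' (hcross q hq p hp)
  · exact Or.inr (heq c d hp hq)

theorem IsLinkPair.swap_left (h : IsLinkPair T u a b c d) : IsLinkPair T u b a c d where
  nodup := (h.nodup.perm (((List.Perm.swap _ _ _)).cons _))
  left := h.left.swap'
  right := h.right
  subset := insert_comm a b _ ▸ h.subset
  eq_or_eq := pair_comm a b ▸ h.eq_or_eq

theorem IsLinkPair.swap (h : IsLinkPair T u a b c d) : IsLinkPair T u c d a b where
  nodup := h.nodup.perm ((List.perm_append_comm (l₁ := [a, b]) (l₂ := [c, d])).cons u)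
  left := h.right
  right := h.left
  subset σ hσ := (h.subset σ hσ).trans (by simp [insert_subset_iff])
  eq_or_eq σ hσ hu := (h.eq_or_eq σ hσ hu).symm

theorem IsLinkPair.swap_right (h : IsLinkPair T u a b c d) : IsLinkPair T u a b d c :=
  h.swap.swap_left.swap

theorem eq_or_eq_of_subset_of_card_eq_three (h : [a, b, c, d].Nodup) {σ : Finset E}
    (hσ : σ ⊆ {a, b, c, d}) (h3 : #σ = 3) :
    σ = {a, b, c} ∨ σ = {a, b, d} ∨ σ = {a, c, d} ∨ σ = {b, c, d} := by
  have h4 : #{a, b, c, d} = 4 := by simpa using List.toFinset_card_of_nodup h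
  obtain ⟨x, hx, hxσ⟩ := exists_mem_notMem_of_card_lt_card (show #σ < #{a, b, c, d} by omega)
  have heq : ∀ p q r, {a, b, c, d} ⊆ ({x, p, q, r} : Finset E) → σ = {p, q, r} := fun p q r hle =>
    eq_of_subset_of_card_le ((subset_insert_iff_of_notMem hxσ).1 (hσ.trans hle))
      (h3.symm ▸ card_le_three)
  simp only [mem_insert, mem_singleton] at hx
  obtain rfl | rfl | rfl | rfl := hx
  · exact Or.inr (Or.inr (Or.inr (heq b c d subset_rfl)))
  · exact Or.inr (Or.inr (Or.inl (heq a c d (by simp [insert_subset_iff]))))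
  · exact Or.inr (Or.inl (heq a b d (by simp [insert_subset_iff])))
  · exact Or.inl (heq a b c (by simp [insert_subset_iff]))

theorem IsLinkPair.eq_or_eq_of_mem (h : IsLinkPair T u a b c d)
    (hT : (T : Set (Finset E)).Sized 3) {σ : Finset E} (hσ : σ ∈ T) :
    (σ = {u, a, b} ∨ σ = {u, c, d}) ∨
      σ = {a, b, c} ∨ σ = {a, b, d} ∨ σ = {a, c, d} ∨ σ = {b, c, d} := by
  by_cases hu : u ∈ σ
  · exact Or.inl (h.eq_or_eq σ hσ hu)
  · exact Or.inr (eq_or_eq_of_subset_of_card_eq_three h.nodup.of_cons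
      ((subset_insert_iff_of_notMem hu).1 (h.subset σ hσ)) (hT hσ))

theorem IsObstruction.containsMinimal_of_isLinkPair_of_faces (h : Γ.IsObstruction) (hd : Γ.dim = 2)
    (hL : IsLinkPair Γ.triangles u a b c d) {F : Finset (Finset (Fin 7))}
    (hF : generatedBy (insert {0, 1, 2} (insert {0, 3, 4} F)) ∈ twelveComplexes)
    (hF5 : ∀ t ∈ F, ∀ i ∈ t, i.val < 5)
    (hfaces : ∀ e ∈ F, e.image (fun i => [u, a, b, c, d].getD i.val u) ∈ Γ.faces)
    (hcard : #Γ.triangles ≤ #{t ∈ insert {0, 1, 2} (insert {0, 3, 4} F) | #t = 3}) :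
    Γ.ContainsMinimal := by
  refine h.containsMinimal_of_nodup hd hF hL.nodup u
    ((forall_mem_insert _ _ _).2 ⟨by simp, (forall_mem_insert _ _ _).2 ⟨by simp, hF5⟩⟩) ?_ hcard
  simp only [forall_mem_insert, image_insert, image_singleton]
  exact ⟨(mem_triangles.1 hL.left).1, (mem_triangles.1 hL.right).1, hfaces⟩

theorem IsObstruction.containsMinimal_of_isLinkPair_of_iff (h : Γ.IsObstruction) (hd : Γ.dim = 2)
    (hL : IsLinkPair Γ.triangles u a b c d) {F : Finset (Finset (Fin 7))}
    (hF : generatedBy (insert {0, 1, 2} (insert {0, 3, 4} F)) ∈ twelveComplexes)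
    (hF₄ : F ⊆ {{1, 2, 3}, {1, 2, 4}, {1, 3, 4}, {2, 3, 4}})
    (habc : Tri Γ.triangles a b c ↔ {1, 2, 3} ∈ F) (habd : Tri Γ.triangles a b d ↔ {1, 2, 4} ∈ F)
    (hacd : Tri Γ.triangles a c d ↔ {1, 3, 4} ∈ F) (hbcd : Tri Γ.triangles b c d ↔ {2, 3, 4} ∈ F) :
    Γ.ContainsMinimal := by
  let f (i : Fin 7) : E := [u, a, b, c, d].getD i.val u
  have hf : image f {0, 1, 2} = {u, a, b} ∧ image f {0, 3, 4} = {u, c, d} ∧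
      image f {1, 2, 3} = {a, b, c} ∧ image f {1, 2, 4} = {a, b, d} ∧
      image f {1, 3, 4} = {a, c, d} ∧ image f {2, 3, 4} = {b, c, d} := by
    simp only [image_insert, image_singleton]
    exact ⟨rfl, rfl, rfl, rfl, rfl, rfl⟩
  obtain ⟨huab, hucd, habc', habd', hacd', hbcd'⟩ := hf
  have hquad : ∀ t ∈ F, #t = 3 ∧ (∀ i ∈ t, i.val < 5) ∧ t.image f ∈ Γ.faces := by
    intro t ht
    have ht₄ := hF₄ ht
    simp only [mem_insert, mem_singleton] at ht₄
    obtain rfl | rfl | rfl | rfl := ht₄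
    · exact ⟨by decide, by decide, habc' ▸ (mem_triangles.1 (habc.2 ht)).1⟩
    · exact ⟨by decide, by decide, habd' ▸ (mem_triangles.1 (habd.2 ht)).1⟩
    · exact ⟨by decide, by decide, hacd' ▸ (mem_triangles.1 (hacd.2 ht)).1⟩
    · exact ⟨by decide, by decide, hbcd' ▸ (mem_triangles.1 (hbcd.2 ht)).1⟩
  have hsub : Γ.triangles ⊆ (insert {0, 1, 2} (insert {0, 3, 4} F)).image (image f) := by
    intro σ hσ
    rw [image_insert (image f), image_insert (image f), mem_insert, mem_insert, huab, hucd,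
      ← or_assoc]
    refine (hL.eq_or_eq_of_mem sized_triangles hσ).imp_right ?_
    rintro (rfl | rfl | rfl | rfl)
    exacts [habc' ▸ mem_image_of_mem _ (habc.1 hσ), habd' ▸ mem_image_of_mem _ (habd.1 hσ),
      hacd' ▸ mem_image_of_mem _ (hacd.1 hσ), hbcd' ▸ mem_image_of_mem _ (hbcd.1 hσ)]
  refine h.containsMinimal_of_isLinkPair_of_faces hd hL hF (fun t ht => (hquad t ht).2.1)
    (fun t ht => (hquad t ht).2.2) ((card_le_card hsub).trans (card_image_le.trans_eq ?_))
  rw [filter_true_of_mem]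
  exact (forall_mem_insert _ _ _).2 ⟨by decide, (forall_mem_insert _ _ _).2
    ⟨by decide, fun t ht => (hquad t ht).1⟩⟩

theorem IsObstruction.containsMinimal_of_isLinkPair_of_two (h : Γ.IsObstruction) (hd : Γ.dim = 2)
    (hL : IsLinkPair Γ.triangles u a b c d)
    (hT : ∀ σ ∈ Γ.triangles, σ = {u, a, b} ∨ σ = {u, c, d}) : Γ.ContainsMinimal := by
  have h2 : #Γ.triangles ≤ 2 := (card_le_card (t := {{u, a, b}, {u, c, d}})
    fun σ hσ => by simpa using hT σ hσ).trans card_le_two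
  have key : ∀ {a b c d : E}, IsLinkPair Γ.triangles u a b c d → {a, c} ∈ Γ.faces →
      Γ.ContainsMinimal := fun hL hac => h.containsMinimal_of_isLinkPair_of_faces hd hL
    (show complex2 ∈ _ by simp [twelveComplexes]) (by decide +kernel)
    (by simp only [mem_singleton, forall_eq, image_insert, image_singleton]; exact hac)
    (h2.trans (by decide +kernel))
  have hnot : ¬ Γ.IsInducedTwoK2 a b c d := h.twoK2Free hd a b c d
  by_contra hne
  have hnodup := hL.nodup
  simp only [List.nodup_cons, List.mem_cons, List.not_mem_nil, or_false, not_or] at hnodup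
  refine hnot ⟨by tauto, by tauto, pair_mem_faces (mem_triangles.1 hL.left).1 (by simp) (by simp),
    pair_mem_faces (mem_triangles.1 hL.right).1 (by simp) (by simp), ?_⟩
  simp only [mem_insert, mem_singleton, forall_eq_or_imp, forall_eq]
  exact ⟨⟨mt (key hL) hne, mt (key hL.swap_right) hne⟩, mt (key hL.swap_left) hne,
    mt (key hL.swap_left.swap_right) hne⟩

theorem IsObstruction.containsMinimal_of_isLinkPair_of_imp (h : Γ.IsObstruction) (hd : Γ.dim = 2)
    (hL : IsLinkPair Γ.triangles u a b c d)
    (habd_abc : Tri Γ.triangles a b d → Tri Γ.triangles a b c)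
    (hbcd_acd : Tri Γ.triangles b c d → Tri Γ.triangles a c d)
    (hacd_abc : Tri Γ.triangles a c d → Tri Γ.triangles a b c)
    (hbcd_abd : Tri Γ.triangles b c d → Tri Γ.triangles a b d) : Γ.ContainsMinimal := by
  have key (F : Finset (Finset (Fin 7))) := h.containsMinimal_of_isLinkPair_of_iff hd hL (F := F)
  by_cases habc : Tri Γ.triangles a b c
  · by_cases habd : Tri Γ.triangles a b d
    · by_cases hacd : Tri Γ.triangles a c d
      · by_cases hbcd : Tri Γ.triangles b c d
        · exact key {{1, 2, 3}, {1, 2, 4}, {1, 3, 4}, {2, 3, 4}}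
            (show complex3e ∈ _ by simp [twelveComplexes]) (by decide)
            (iff_of_true habc (by decide)) (iff_of_true habd (by decide))
            (iff_of_true hacd (by decide)) (iff_of_true hbcd (by decide))
        · exact key {{1, 2, 3}, {1, 2, 4}, {1, 3, 4}}
            (show complex3d ∈ _ by simp [twelveComplexes]) (by decide)
            (iff_of_true habc (by decide)) (iff_of_true habd (by decide))
            (iff_of_true hacd (by decide)) (iff_of_false hbcd (by decide))
      · exact key {{1, 2, 3}, {1, 2, 4}}
          (show complex3b ∈ _ by simp [twelveComplexes]) (by decide)
          (iff_of_true habc (by decide)) (iff_of_true habd (by decide))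
          (iff_of_false hacd (by decide)) (iff_of_false (mt hbcd_acd hacd) (by decide))
    · have hbcd := mt hbcd_abd habd
      by_cases hacd : Tri Γ.triangles a c d
      · exact key {{1, 2, 3}, {1, 3, 4}}
          (show complex3c ∈ _ by simp [twelveComplexes]) (by decide)
          (iff_of_true habc (by decide)) (iff_of_false habd (by decide))
          (iff_of_true hacd (by decide)) (iff_of_false hbcd (by decide))
      · exact key {{1, 2, 3}}
          (show complex3a ∈ _ by simp [twelveComplexes]) (by decide)
          (iff_of_true habc (by decide)) (iff_of_false habd (by decide))
          (iff_of_false hacd (by decide)) (iff_of_false hbcd (by decide))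
  · have hacd := mt hacd_abc habc
    refine h.containsMinimal_of_isLinkPair_of_two hd hL (fun σ hσ => ?_)
    refine (hL.eq_or_eq_of_mem sized_triangles hσ).resolve_right ?_
    rintro (rfl | rfl | rfl | rfl)
    exacts [habc hσ, mt habd_abc habc hσ, hacd hσ, mt hbcd_acd hacd hσ]

/-- The symmetries of the link pair arrange that `ab` lies in at least as many of the four triangles
on `a`, `b`, `c`, `d` as `cd`, and that `abc` and `acd` are preferred to `abd` and `bcd`. -/
theorem IsObstruction.containsMinimal_of_isLinkPair (h : Γ.IsObstruction) (hd : Γ.dim = 2)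
    (hL : IsLinkPair Γ.triangles u a b c d) : Γ.ContainsMinimal := by
  have hrot : ∀ x y z, Tri Γ.triangles x y z ↔ Tri Γ.triangles y z x := fun _ _ _ =>
    ⟨Tri.rot, Tri.rot'⟩
  have hswap : ∀ x y z, Tri Γ.triangles y x z ↔ Tri Γ.triangles x y z := fun _ _ _ =>
    ⟨Tri.swap, Tri.swap⟩
  have hswap' : ∀ x y z, Tri Γ.triangles x z y ↔ Tri Γ.triangles x y z := fun _ _ _ =>
    ⟨Tri.swap', Tri.swap'⟩
  wlog hpairs : (Tri Γ.triangles a c d ∧ Tri Γ.triangles b c d →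
      Tri Γ.triangles a b c ∧ Tri Γ.triangles a b d) ∧
    (Tri Γ.triangles a c d ∨ Tri Γ.triangles b c d →
      Tri Γ.triangles a b c ∨ Tri Γ.triangles a b d) generalizing a b c d
  · refine this hL.swap ?_
    rw [hrot c a b, hrot d a b, ← hrot a c d, ← hrot b c d]
    tauto
  wlog hcd : Tri Γ.triangles a b d → Tri Γ.triangles a b c generalizing c d
  · exact this hL.swap_right (by rw [hswap' a c d, hswap' b c d]; tauto) (by tauto)
  wlog hab : Tri Γ.triangles b c d → Tri Γ.triangles a c d generalizing a b
  · exact this hL.swap_left (by rw [hswap a b c, hswap a b d]; tauto)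
      (by rw [hswap a b c, hswap a b d]; tauto) (by tauto)
  exact h.containsMinimal_of_isLinkPair_of_imp hd hL hcd hab (by tauto) (by tauto)

theorem IsObstruction.containsMinimal (h : Γ.IsObstruction) (hd : Γ.dim = 2) :
    Γ.ContainsMinimal := by
  obtain ⟨-, hC, -⟩ := (isObstruction_iff_of_dim_eq_two hd).1 h
  by_cases hD : TwoDisjoint Γ.triangles
  · exact h.containsMinimal_of_twoDisjoint hd hD
  by_cases hL : LinksTwoK2Free Γ.triangles
  · exact h.containsMinimal_of_isBand_five_six_seven hd
      (hC.exists_isBand hL hD)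
  · simp only [LinksTwoK2Free, not_forall] at hL
    obtain ⟨u, a, b, c, d, hab, hcd, hac, had, hbc, hbd, hn⟩ := hL
    exact h.containsMinimal_of_isLinkPair hd (hC.isLinkPair hab hcd hac had hbc hbd hn)

end LinkPair

section TwoK2

variable {E : Type*} [DecidableEq E] {Γ : FinComplex E} {a b c d : E}

theorem isShellable_of_card_le_two (hΓ : ∀ s ∈ Γ.faces, #s ≤ 2) (hG : Γ.TwoK2Free) :
    Γ.IsShellable := by
  have hT : Γ.triangles = ∅ := filter_false_of_mem fun s hs h3 => by
    have := hΓ s hs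
    omega
  exact isShellable_of_shelled_triangles (fun s hs => (hΓ s hs).trans (by omega)) hG
    (hT ▸ Shelled.empty)

theorem mem_map_twoK2 {f : Fin 4 → E} {s : Finset E} :
    s ∈ (twoK2.map f).faces ↔ s ⊆ {f 0, f 1} ∨ s ⊆ {f 2, f 3} := by
  have himage : ∀ i j, ({f i, f j} : Finset E) = image f {i, j} := fun i j => by
    rw [image_insert, image_singleton]
  rw [himage, himage, subset_image_iff, subset_image_iff, ← exists_or, mem_map]
  refine exists_congr fun u => ?_
  simp only [twoK2, mem_generatedBy, mem_insert, mem_singleton, exists_eq_or_imp, exists_eq_left,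
    ← or_and_right]
  rw [or_iff_right_of_imp]
  rintro rfl
  exact Or.inl (empty_subset _)

theorem vertexSet_twoK2 : twoK2.vertexSet = Set.univ := by
  refine Set.eq_univ_of_forall fun x => mem_vertexSet_generatedBy.2 ?_
  revert x
  decide +kernel

theorem image_univ_fin_four (f : Fin 4 → E) : univ.image f = {f 0, f 1} ∪ {f 2, f 3} := by
  rw [show (univ : Finset (Fin 4)) = {0, 1} ∪ {2, 3} by decide, image_union]
  simp only [image_insert, image_singleton]

theorem IsInducedTwoK2.card_eq (h : Γ.IsInducedTwoK2 a b c d) :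
    #({a, b} ∪ {c, d} : Finset E) = 4 := by
  rw [card_union_of_disjoint h.disjoint, card_pair h.left_ne, card_pair h.right_ne]

theorem IsInducedTwoK2.isIso_twoK2 (h : Γ.IsInducedTwoK2 a b c d)
    (hV : Γ.vertexSet = ({a, b} ∪ {c, d} : Finset E)) : Γ.IsIso twoK2 := by
  have hmap : Γ = twoK2.map ![a, b, c, d] := by
    ext s
    rw [mem_map_twoK2]
    refine ⟨fun hs => h.subset_or_subset ?_, ?_⟩
    · rwa [restrict_eq_self hV.le]
    · rintro (hs | hs)
      exacts [Γ.down_closed _ h.left_mem _ hs, Γ.down_closed _ h.right_mem _ hs]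
  have hcard : #(univ.image ![a, b, c, d]) = #(univ : Finset (Fin 4)) := by
    rw [image_univ_fin_four, card_univ, Fintype.card_fin]
    exact h.card_eq
  rw [hmap]
  exact isIso_map (card_image_iff.1 hcard |>.mono (by simp))

theorem IsIso.exists_isInducedTwoK2 (h : Γ.IsIso twoK2) :
    (∀ s ∈ Γ.faces, #s ≤ 2) ∧ ∃ a b c d, Γ.IsInducedTwoK2 a b c d ∧
      Γ.vertexSet = ({a, b} ∪ {c, d} : Finset E) := by
  obtain ⟨f, hf, rfl⟩ := h.exists_map (vertexSet_twoK2 ▸ Set.univ_nonempty)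
  rw [vertexSet_twoK2, Set.injOn_univ] at hf
  refine ⟨fun s hs => ?_, f 0, f 1, f 2, f 3, ⟨hf.ne (by decide), hf.ne (by decide),
    mem_map_twoK2.2 (Or.inl subset_rfl), mem_map_twoK2.2 (Or.inr subset_rfl), ?_⟩, ?_⟩
  · obtain hs | hs := mem_map_twoK2.1 hs <;> exact (card_le_card hs).trans card_le_two
  · simp [mem_map_twoK2, insert_subset_iff, hf.eq_iff]
  · rw [vertexSet_map, vertexSet_twoK2, ← image_univ_fin_four, coe_image, coe_univ]

theorem IsObstruction.isIso_twoK2 (h : Γ.IsObstruction) (hΓ : ∀ s ∈ Γ.faces, #s ≤ 2) :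
    Γ.IsIso twoK2 := by
  have hG : ¬ Γ.TwoK2Free := fun hG => h.1 (isShellable_of_card_le_two hΓ hG)
  simp only [TwoK2Free, not_forall, not_not] at hG
  obtain ⟨a, b, c, d, hind⟩ := hG
  exact hind.isIso_twoK2 (h.vertexSet_eq_of_isInducedTwoK2 hind)

theorem IsIso.isObstruction_of_twoK2 (h : Γ.IsIso twoK2) : Γ.IsObstruction := by
  obtain ⟨hΓ, a, b, c, d, hind, hV⟩ := h.exists_isInducedTwoK2
  refine ⟨?_, fun W hW => ?_⟩
  · rw [← restrict_eq_self hV.le]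
    exact hind.not_isShellable_restrict
  · refine isShellable_of_card_le_two (fun s hs => hΓ s (mem_restrict.1 hs).1)
      fun p q r s hind' => ?_
    have hsub : {p, q} ∪ {r, s} ⊆ W :=
      union_subset (mem_restrict.1 hind'.left_mem).2 (mem_restrict.1 hind'.right_mem).2
    rw [hV, coe_ssubset] at hW
    have hlt := (card_le_card hsub).trans_lt (card_lt_card hW)
    rw [hind'.card_eq, hind.card_eq] at hlt
    exact lt_irrefl _ hlt

end TwoK2

section Models

variable {E : Type*} [DecidableEq E] {Γ : FinComplex E}

theorem IsIso.isMinimalModel {Δ : FinComplex (Fin 7)} (h : Γ.IsIso Δ) (hΔ : Δ ∈ twelveComplexes) :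
    Γ.IsMinimalModel := by
  have hmodel := isMinimalModel_of_mem_twelveComplexes hΔ
  obtain ⟨t, ht⟩ := hmodel.critical.nonempty
  rw [mem_triangles] at ht
  obtain ⟨x, hx⟩ := card_pos.1 (show 0 < #t by omega)
  obtain ⟨f, hf, rfl⟩ := h.exists_map ⟨x, mem_vertexSet_of_mem ht.1 hx⟩
  exact hmodel.map hf

end Models

end FinComplex

theorem theorem2 {E : Type*} [DecidableEq E] (Γ : FinComplex E) :
    (Γ.IsEdgeMinimalObstruction ↔ ∃ Δ ∈ FinComplex.twelveComplexes, Γ.IsIso Δ) ∧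
    ((Γ.IsObstruction ∧ Γ.dim ≤ 2) ↔
      (Γ.IsIso FinComplex.twoK2 ∨
        ∃ Δ ∈ FinComplex.twelveComplexes, ∃ Γ₀ : FinComplex E,
          Γ₀.IsIso Δ ∧ FinComplex.IsAddEdges Γ₀ Γ)) := by
  refine ⟨⟨?_, ?_⟩, ?_, ?_⟩
  · rintro ⟨⟨h, hd⟩, hmin⟩
    obtain ⟨Δ, hΔ, Γ₀, hiso, hadd⟩ := h.containsMinimal hd
    obtain ⟨h₀, hd₀⟩ := (hiso.isMinimalModel hΔ).isObstruction_of_isAddEdges (.refl Γ₀)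
    exact ⟨Δ, hΔ, hmin Γ₀ h₀ hd₀ hadd ▸ hiso⟩
  · rintro ⟨Δ, hΔ, hiso⟩
    have hmodel := hiso.isMinimalModel hΔ
    exact ⟨hmodel.isObstruction_of_isAddEdges (.refl Γ), fun _ => hmodel.eq_of_isAddEdges⟩
  · rintro ⟨h, hd⟩
    obtain hd | hd := hd.lt_or_eq
    · exact Or.inl (h.isIso_twoK2 (FinComplex.dim_le_iff.1 (Int.lt_add_one_iff.1 hd)))
    · exact Or.inr (h.containsMinimal hd)
  · rintro (hiso | ⟨Δ, hΔ, Γ₀, hiso, hadd⟩)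
    · have hd : Γ.dim ≤ (1 : ℕ) := FinComplex.dim_le_iff.2 hiso.exists_isInducedTwoK2.1
      exact ⟨hiso.isObstruction_of_twoK2, hd.trans (by norm_num)⟩
    · exact (hiso.isMinimalModel hΔ).isObstruction_of_isAddEdges hadd |>.imp_right le_of_eq
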